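/- Conventions. A tile system $\Gamma=(T,\sigma,\tau)$ of the abstract tile assembly model (aTAM) consists of a finite set $T$ of tile types (unit squares with a glue on each edge, each glue having a non-negative integer strength), a seed assembly $\sigma$ made of translates of tile types at distinct positions of $\mathbb{Z}^2$, and a temperature $\tau\ge 1$. Starting from $\sigma$, single tiles are added at empty positions whenever the resulting assembly is $\tau$-stable, i.e. every cut of its bond graph (abutting equal glues bond with their strength) has weight at least $\tau$; the assemblies so obtained are producible, and those to which nothing can be added are terminal. $\Gamma$ is finite if every producible assembly can grow into a terminal one; its space is then the maximal number of tiles of a terminal assembly. $\Gamma$ is $k$-extensible if to each producible assembly tiles can be added in at most $k$ different locations. A concentration distribution is a $P:T\to(0,\infty)$ with $\sum_{t}P(t)=1$; it makes the growth process a Markov chain starting at $\sigma$ in which, at each step, each possible attachment is chosen with probability proportional to the concentration of the attached tile type. $\Gamma$ is a robust random $n$ generator with bias $b$ if it is finite and its terminal assemblies can be partitioned into $n$ (nonempty) sets $X_1,\dots,X_n$ such that, for every concentration distribution and all $i,j$, the probabilities that the process ends in $X_i$ and in $X_j$ differ by at most $b$. Theorem. There are constants $c_1,c_2,C>0$ such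 that for all integers $n\ge 2$ and $s$ with $s>25\lceil\log_2 n\rceil$ there exists a $2$-extensible tile system $\Gamma=(T,\sigma,2)$ at temperature $2$ with $|\sigma|=1$, with space at most $s$ and with $|T|\le C\,(s+\log_2 n)$, which is a robust random $n$ generator with bias $2^{-e}$ for some real $e$ satisfying $$c_1\,\frac{s}{\log_2 n}\;\le\; e\;\le\; c_2\,\frac{s}{\log_2 n},$$ that is, with bias $1/2^{\Theta(s/\log n)}$. -/

import Mathlib

open scoped NNReal ENNReal

/-- A tile system `Γ = (T, σ, τ)` of the abstract tile assembly model, with glue types `G` and tile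
set `T` (below, `T` is a finite type). Each glue type has a strength, and each tile type carries a
glue on each of its four edges (distinct elements of `T` with the same four glues are tile types
that differ in their label). The seed `σ` is an assembly: a finite set of tiles (translations of
tile types, given by the position of the center and the tile type) with distinct positions. -/
structure TileSystem (G T : Type) where
  strength : G → ℕ
  north : T → G
  east : T → G
  south : T → G
  west : T → G
  seed : Finset ((ℤ × ℤ) × T)
  seed_coords : ∀ a ∈ seed, ∀ b ∈ seed, a.1 = b.1 → a = b
  temperature : ℕ
  temperature_pos : 0 < temperature

/-- The translations `T*` of the tile types in `T`: a position together with a tile type. -/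
abbrev PlacedTile (T : Type) : Type := (ℤ × ℤ) × T

/-- Finite sets of placed tiles. Assemblies are those with pairwise distinct positions; this holds
for the seed by assumption, and is preserved by attachments, which only use empty positions. -/
abbrev Assembly (T : Type) : Type := Finset (PlacedTile T)

/-- A concentration distribution over the tile set. -/
structure Concentration (T : Type) [Fintype T] where
  conc : T → ℝ≥0
  conc_pos : ∀ t, 0 < conc t
  sum_conc : ∑ t, conc t = 1

namespace TileSystem

variable {G T : Type} [DecidableEq G] [Fintype T] [DecidableEq T] (Γ : TileSystem G T)

/-- The strength of the bond formed by two abutting glues. -/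
def glueBond (g g' : G) : ℕ := if g = g' then Γ.strength g else 0

/-- The weight of the edge between two tiles in the bond graph. -/
def bond (a b : PlacedTile T) : ℕ :=
  if b.1 = a.1 + (0, 1) then Γ.glueBond (Γ.north a.2) (Γ.south b.2)
  else if b.1 = a.1 + (1, 0) then Γ.glueBond (Γ.east a.2) (Γ.west b.2)
  else if b.1 = a.1 + (0, -1) then Γ.glueBond (Γ.south a.2) (Γ.north b.2)
  else if b.1 = a.1 + (-1, 0) then Γ.glueBond (Γ.west a.2) (Γ.east b.2)
  else 0

/-- `τ`-stability: every cut of the bond graph of `A` has weight at least `τ`. -/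
def IsStable (A : Assembly T) : Prop :=
  ∀ S : Assembly T, S ⊆ A → S.Nonempty → S ≠ A →
    Γ.temperature ≤ ∑ a ∈ S, ∑ b ∈ A \ S, Γ.bond a b

/-- The frontier of `A`: the tiles, at positions not occupied in `A`, whose addition to `A` gives a
stable assembly. -/
def frontier (A : Assembly T) : Set (PlacedTile T) :=
  {b | (∀ a ∈ A, a.1 ≠ b.1) ∧ Γ.IsStable (insert b A)}

/-- `A →₁ B`: `A` grows into `B` by the attachment of one tile. -/
def Attaches (A B : Assembly T) : Prop :=
  ∃ b ∈ Γ.frontier A, B = insert b A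

/-- The producible assemblies of `Γ`. -/
inductive Producible : Assembly T → Prop
  | seed : Producible Γ.seed
  | attach {A B : Assembly T} : Producible A → Γ.Attaches A B → Producible B

/-- The terminal assemblies of `Γ`: the producible ones to which no tile can attach. -/
def terminal : Set (Assembly T) :=
  {A | Γ.Producible A ∧ Γ.frontier A = ∅}

/-- `Γ` is finite: every producible assembly can grow into a terminal one. -/
def IsFinite : Prop :=
  ∀ B, Γ.Producible B → ∃ A ∈ Γ.terminal, Relation.ReflTransGen Γ.Attaches B A

/-- The space of a (finite) tile system: the maximal size of a terminal assembly, and `⊤` if these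
sizes are unbounded. -/
noncomputable def space : ℕ∞ := ⨆ A ∈ Γ.terminal, (A.card : ℕ∞)

/-- The locations at which some tile can attach to `A`. -/
def locations (A : Assembly T) : Set (ℤ × ℤ) := Prod.fst '' Γ.frontier A

/-- `Γ` is `k`-extensible: each producible assembly can grow in at most `k` locations. -/
def IsExtensible (k : ℕ) : Prop :=
  ∀ A, Γ.Producible A → (Γ.locations A).encard ≤ k

open Classical in
/-- The concentration of the tile type that is added when `A` grows into `B` in one step (then
`B \ A` consists of exactly one tile), and `0` if `A` does not grow into `B` in one step. -/
noncomputable def rate (P : Concentration T) (A B : Assembly T) : ℝ≥0∞ :=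
  if Γ.Attaches A B then ∑ b ∈ B \ A, (P.conc b.2 : ℝ≥0∞) else 0

/-- The transition probability from `A` to `B` of the assembly process. -/
noncomputable def trans (P : Concentration T) (A B : Assembly T) : ℝ≥0∞ :=
  Γ.rate P A B / ∑' C, Γ.rate P A C

/-- The probability that the assembly process, started at the seed, makes at least `k` attachments
and is in state `B` after exactly `k` of them. -/
noncomputable def reachProb (P : Concentration T) : ℕ → Assembly T → ℝ≥0∞
  | 0, B => if B = Γ.seed then 1 else 0
  | k + 1, B => ∑' A, reachProb P k A * Γ.trans P A B

/-- For a terminal assembly `A`, the probability that the assembly process ends in `A`: the sum over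
`k` of the probability that it arrives at `A`, and hence stops, after exactly `k` attachments. -/
noncomputable def termProb (P : Concentration T) (A : Assembly T) : ℝ≥0∞ :=
  ∑' k, Γ.reachProb P k A

/-- `Γ` is a robust random `n` generator with bias `β`: it is finite, and its terminal assemblies
can be partitioned into `n` sets such that, for all concentration distributions, the probabilities
of ending in any two of these sets differ by at most `β`. -/
def IsRobustRandomGenerator (n : ℕ) (β : ℝ) : Prop :=
  Γ.IsFinite ∧
    ∃ X : Fin n → Set (Assembly T),
      (∀ i, (X i).Nonempty) ∧
      (∀ i j, i ≠ j → Disjoint (X i) (X j)) ∧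
      (⋃ i, X i) = Γ.terminal ∧
      ∀ (P : Concentration T) (i j : Fin n),
        |(∑' A : X i, Γ.termProb P A.1).toReal - (∑' A : X j, Γ.termProb P A.1).toReal| ≤ β

end TileSystem

/-! The construction is a strip three columns wide that tosses `M` coins in succession, one every
four rows. Each coin is exactly fair for every concentration distribution.

A coin is a race. Once the launch tile is placed, each side column needs three attachments to decide
the coin, the third being the coin tile itself. The right column uses the tile types `rightStart`,
`relay`, `leftStart` in this order, and the left column uses `leftStart`, `relay`, `rightStart`.
With independent exponential clocks whose rates are the concentrations, both total times are sums of
the same three exponential variables, so they have the same law and each side wins with probability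
1/2 (`race_three`). Both results expose the same glue to the north, and the next gate opens only
when both side columns have caught up, so the next race starts afresh.

Hence the terminal assemblies correspond to the `2 ^ M` sequences of results, and each has
probability exactly `(1 / 2) ^ M` (`termProb_outcome`). Sorting them into `n` residue classes gives
class sizes that differ by at most one, so the bias is at most `(1 / 2) ^ M`
(`isRobustRandomGenerator`). A choice of `M` proportional to `s` meets the bounds on space and
number of tile types.

Two reductions carry the verification. Stability of an enlarged assembly is a condition on the bonds
of the new tile alone (`isStable_insert`), so the frontier can be computed position by position
(`mem_frontier`) and every producible assembly is described by three column heights and the coin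
results (`Producible.exists_asm`). The probability of a given ending is identified by exhibiting a
function that is harmonic except for a unit source (`termProb_eq_of_harmonic`, `endProb_harmonic`),
which avoids summing over growth histories. -/

set_option linter.unusedSectionVars false
set_option linter.unusedSimpArgs false
set_option linter.unnecessarySeqFocus false

namespace TileSystem

/-! ### Stability and attachment in an arbitrary tile system -/

section General

variable {G T : Type} [DecidableEq G] [Fintype T] [DecidableEq T] (Γ : TileSystem G T)

theorem glueBond_comm (g g' : G) : Γ.glueBond g g' = Γ.glueBond g' g := by
  unfold glueBond
  by_cases h : g = g'
  · subst h; rfl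
  · rw [if_neg h, if_neg (Ne.symm h)]

/-- The bond of `b` with `a` as a sum over the four directions. -/
theorem bond_eq_sum (b a : PlacedTile T) :
    Γ.bond b a =
      (if a.1 = b.1 + (0, 1) then Γ.glueBond (Γ.north b.2) (Γ.south a.2) else 0) +
      (if a.1 = b.1 + (1, 0) then Γ.glueBond (Γ.east b.2) (Γ.west a.2) else 0) +
      (if a.1 = b.1 + (0, -1) then Γ.glueBond (Γ.south b.2) (Γ.north a.2) else 0) +
      (if a.1 = b.1 + (-1, 0) then Γ.glueBond (Γ.west b.2) (Γ.east a.2) else 0) := by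
  obtain ⟨⟨x, y⟩, t⟩ := a
  obtain ⟨⟨x', y'⟩, t'⟩ := b
  simp only [bond, Prod.mk_add_mk, Prod.mk.injEq]
  split_ifs <;> omega

theorem bond_comm (a b : PlacedTile T) : Γ.bond a b = Γ.bond b a := by
  obtain ⟨⟨x, y⟩, t⟩ := a
  obtain ⟨⟨x', y'⟩, t'⟩ := b
  simp only [bond, Prod.mk_add_mk, Prod.mk.injEq]
  split_ifs <;> first | omega | exact Γ.glueBond_comm _ _

/-- A cut of the enlarged assembly either induces a proper cut of `A`, already heavy enough, or
separates `b` from all of `A`. Only the latter gives a new condition. -/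
theorem isStable_insert {A : Assembly T} {b : PlacedTile T} (hA : Γ.IsStable A)
    (hne : A.Nonempty) (hb : b ∉ A) :
    Γ.IsStable (insert b A) ↔ Γ.temperature ≤ ∑ a ∈ A, Γ.bond b a := by
  constructor
  · intro h
    have := h {b} (by simp) (by simp) (by
      intro h
      obtain ⟨a, ha⟩ := hne
      have : a ∈ ({b} : Assembly T) := h ▸ Finset.mem_insert_of_mem ha
      rw [Finset.mem_singleton] at this
      exact hb (this ▸ ha))
    rwa [Finset.sum_singleton, Finset.insert_sdiff_of_mem _ (Finset.mem_singleton_self b),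
      Finset.sdiff_singleton_eq_erase, Finset.erase_eq_of_notMem hb] at this
  · intro h S hS hSne hSA
    by_cases hbS : b ∈ S
    · have hsd : insert b A \ S = A \ S.erase b := by
        ext x
        simp only [Finset.mem_sdiff, Finset.mem_insert, Finset.mem_erase]
        constructor
        · rintro ⟨rfl | hx, hxS⟩
          · exact absurd hbS hxS
          · exact ⟨hx, fun h => hxS h.2⟩
        · rintro ⟨hx, hxS⟩
          refine ⟨Or.inr hx, fun hxS' => hxS ⟨?_, hxS'⟩⟩
          rintro rfl
          exact hb hx
      rw [hsd]
      by_cases he : (S.erase b).Nonempty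
      · refine (hA (S.erase b) ?_ he ?_).trans ?_
        · intro x hx
          rw [Finset.mem_erase] at hx
          exact (Finset.mem_insert.1 (hS hx.2)).resolve_left hx.1
        · intro h'
          apply hSA
          rw [← h', Finset.insert_erase hbS]
        · exact Finset.sum_le_sum_of_subset (Finset.erase_subset b S)
      · rw [Finset.not_nonempty_iff_eq_empty] at he
        have hS' : S = {b} := by rw [← Finset.insert_erase hbS, he]; rfl
        rw [he, hS', Finset.sum_singleton, Finset.sdiff_empty]
        exact h
    · have hSA' : S ⊆ A := fun x hx =>
        (Finset.mem_insert.1 (hS hx)).resolve_left (fun e => hbS (e ▸ hx))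
      by_cases he : S = A
      · subst he
        rw [Finset.insert_sdiff_of_notMem _ hb, Finset.sdiff_self]
        simp only [insert_empty_eq, Finset.sum_singleton]
        simpa only [Γ.bond_comm _ b] using h
      · refine (hA S hSA' hSne he).trans (Finset.sum_le_sum fun a _ => ?_)
        exact Finset.sum_le_sum_of_subset
          (Finset.sdiff_subset_sdiff (Finset.subset_insert b A) le_rfl)

variable {Γ}

theorem Producible.isStable (hs : Γ.IsStable Γ.seed) {A : Assembly T} (h : Γ.Producible A) :
    Γ.IsStable A := by
  induction h with
  | seed => exact hs
  | attach _ h _ => obtain ⟨b, hb, rfl⟩ := h; exact hb.2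

theorem Producible.nonempty (hs : Γ.seed.Nonempty) {A : Assembly T} (h : Γ.Producible A) :
    A.Nonempty := by
  induction h with
  | seed => exact hs
  | attach _ h _ => obtain ⟨b, _, rfl⟩ := h; exact Finset.insert_nonempty _ _

theorem notMem_of_mem_frontier {A : Assembly T} {b : PlacedTile T} (h : b ∈ Γ.frontier A) :
    b ∉ A := fun hb => h.1 b hb rfl

theorem isStable_of_card_seed (h : Γ.seed.card = 1) : Γ.IsStable Γ.seed := by
  obtain ⟨a, ha⟩ := Finset.card_eq_one.1 h
  intro S hS hne hSne
  rw [ha, Finset.subset_singleton_iff] at hS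
  rcases hS with rfl | rfl
  · simp at hne
  · exact absurd ha.symm hSne

theorem mem_frontier_iff (h1 : Γ.seed.card = 1) {A : Assembly T} (h : Γ.Producible A)
    (b : PlacedTile T) :
    b ∈ Γ.frontier A ↔ (∀ a ∈ A, a.1 ≠ b.1) ∧ Γ.temperature ≤ ∑ a ∈ A, Γ.bond b a := by
  refine and_congr_right fun hb => Γ.isStable_insert (h.isStable (isStable_of_card_seed h1))
    (h.nonempty (Finset.card_pos.1 (by omega))) fun hbA => hb b hbA rfl

theorem card_of_attaches {A B : Assembly T} (h : Γ.Attaches A B) : B.card = A.card + 1 := by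
  obtain ⟨b, hb, rfl⟩ := h
  exact Finset.card_insert_of_notMem (notMem_of_mem_frontier hb)

theorem isFinite_of_card_le (N : ℕ) (h : ∀ A, Γ.Producible A → A.card ≤ N) : Γ.IsFinite := by
  intro B hB
  obtain ⟨d, hd⟩ : ∃ d, N - B.card = d := ⟨_, rfl⟩
  induction d using Nat.strong_induction_on generalizing B with
  | _ d ih =>
    by_cases hf : Γ.frontier B = ∅
    · exact ⟨B, ⟨hB, hf⟩, .refl⟩
    · obtain ⟨b, hb⟩ := Set.nonempty_iff_ne_empty.2 hf
      have hat : Γ.Attaches B (insert b B) := ⟨b, hb, rfl⟩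
      have hp := Producible.attach hB hat
      have h1 := card_of_attaches hat
      have h2 := h _ hp
      obtain ⟨A, hA, hBA⟩ := ih (N - (insert b B).card) (by omega) _ hp rfl
      exact ⟨A, hA, .head hat hBA⟩

/-! ### Harmonic functions of the assembly process -/

variable (P : Concentration T)

open Classical in
theorem tsum_rate_mul {A : Assembly T} {F : Finset (PlacedTile T)} (hF : Γ.frontier A = ↑F)
    (f : Assembly T → ℝ≥0∞) :
    ∑' B, Γ.rate P A B * f B = ∑ b ∈ F, (P.conc b.2 : ℝ≥0∞) * f (insert b A) := by
  have hnot : ∀ b ∈ F, b ∉ A := fun b hb =>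
    notMem_of_mem_frontier (Γ := Γ) (by rw [hF]; exact hb)
  have hinj : Set.InjOn (fun b => insert b A) (F : Set (PlacedTile T)) := by
    intro b hb c hc hbc
    have : b ∈ insert c A := by
      have h := Finset.mem_insert_self b A
      rwa [show insert b A = insert c A from hbc] at h
    exact (Finset.mem_insert.1 this).resolve_right (hnot b hb)
  rw [tsum_eq_sum (s := F.image fun b => insert b A), Finset.sum_image hinj]
  · refine Finset.sum_congr rfl fun b hb => ?_
    have hat : Γ.Attaches A (insert b A) := ⟨b, by rw [hF]; exact hb, rfl⟩
    rw [rate, if_pos hat, Finset.insert_sdiff_of_notMem _ (hnot b hb)]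
    simp
  · intro B hB
    have : ¬ Γ.Attaches A B := by
      rintro ⟨b, hb, rfl⟩
      rw [hF] at hb
      exact hB (Finset.mem_image_of_mem _ hb)
    rw [rate, if_neg this, zero_mul]

/-- The normalising total rate is positive and finite, so it cancels. Harmonicity becomes a
division-free identity over the frontier. -/
theorem tsum_trans_mul_of_balanced {A : Assembly T} {F : Finset (PlacedTile T)}
    (hF : Γ.frontier A = ↑F) (hne : F.Nonempty) (f : Assembly T → ℝ≥0∞)
    (hb : ∑ b ∈ F, (P.conc b.2 : ℝ≥0∞) * f (insert b A) = (∑ b ∈ F, (P.conc b.2 : ℝ≥0∞)) * f A) :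
    ∑' B, Γ.trans P A B * f B = f A := by
  have h1 := tsum_rate_mul (Γ := Γ) P hF 1
  simp only [Pi.one_apply, mul_one] at h1
  have h2 : ∀ B, Γ.trans P A B * f B = (∑ b ∈ F, (P.conc b.2 : ℝ≥0∞))⁻¹ * (Γ.rate P A B * f B) := by
    intro B
    rw [trans, h1, div_eq_mul_inv]
    ring
  simp_rw [h2]
  rw [ENNReal.tsum_mul_left, tsum_rate_mul (Γ := Γ) P hF, hb, ← mul_assoc, ENNReal.inv_mul_cancel, one_mul]
  · obtain ⟨b, hb⟩ := hne
    intro h0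
    rw [Finset.sum_eq_zero_iff] at h0
    have := h0 b hb
    exact (P.conc_pos b.2).ne' (by exact_mod_cast this)
  · exact ENNReal.sum_ne_top.2 fun b _ => ENNReal.coe_ne_top

theorem trans_eq_zero_of_frontier_empty {A : Assembly T} (h : Γ.frontier A = ∅) (B : Assembly T) :
    Γ.trans P A B = 0 := by
  have : ¬ Γ.Attaches A B := by
    rintro ⟨b, hb, _⟩
    rw [h] at hb
    exact hb
  rw [trans, rate, if_neg this, ENNReal.zero_div]

theorem producible_of_reachProb_ne_zero {k : ℕ} {B : Assembly T} (h : Γ.reachProb P k B ≠ 0) :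
    Γ.Producible B ∧ B.card = Γ.seed.card + k := by
  induction k generalizing B with
  | zero =>
    rw [reachProb] at h
    have : B = Γ.seed := by
      by_contra hB
      exact h (if_neg hB)
    subst this
    exact ⟨.seed, rfl⟩
  | succ k ih =>
    rw [reachProb] at h
    obtain ⟨A, hA⟩ : ∃ A, Γ.reachProb P k A * Γ.trans P A B ≠ 0 := by
      by_contra! hall
      exact h (by simp [hall])
    obtain ⟨hp, hc⟩ := ih (left_ne_zero_of_mul hA)
    have hat : Γ.Attaches A B := by
      by_contra hno
      apply right_ne_zero_of_mul hA
      rw [trans, rate, if_neg hno, ENNReal.zero_div]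
    exact ⟨.attach hp hat, by rw [card_of_attaches hat, hc]; omega⟩

/-- A function that is harmonic for the assembly process except for a unit source at `A₀` computes
the probability of ending in `A₀`, provided that the assembly process stops after boundedly many
attachments. -/
theorem termProb_eq_of_harmonic (N : ℕ) (hN : ∀ A, Γ.Producible A → A.card ≤ N) (A₀ : Assembly T)
    (f : Assembly T → ℝ≥0∞)
    (hf : ∀ A, Γ.Producible A →
      f A = ∑' B, Γ.trans P A B * f B + if A = A₀ then 1 else 0) :
    Γ.termProb P A₀ = f Γ.seed := by
  -- The expectation of `f` loses, at each step, exactly the mass that has arrived at `A₀`; these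
  -- losses telescope.
  have step : ∀ k, ∑' A, Γ.reachProb P k A * f A =
      ∑' A, Γ.reachProb P (k + 1) A * f A + Γ.reachProb P k A₀ := by
    intro k
    have h1 : ∀ A, Γ.reachProb P k A * f A =
        ∑' B, Γ.reachProb P k A * Γ.trans P A B * f B +
          if A = A₀ then Γ.reachProb P k A₀ else 0 := by
      intro A
      -- The equation for `f` is known only on producible assemblies; the others carry no mass.
      by_cases h0 : Γ.reachProb P k A = 0
      · have : (if A = A₀ then Γ.reachProb P k A₀ else 0) = 0 := by
          split_ifs with h
          · rw [← h, h0]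
          · rfl
        rw [this]
        simp [h0]
      · conv_lhs => rw [hf A (producible_of_reachProb_ne_zero P h0).1]
        simp_rw [mul_assoc]
        rw [ENNReal.tsum_mul_left, mul_add]
        congr 1
        split_ifs with h
        · rw [h, mul_one]
        · rw [mul_zero]
    rw [tsum_congr h1, ENNReal.tsum_add, ENNReal.tsum_comm, tsum_ite_eq]
    congr 1
    refine tsum_congr fun B => ?_
    rw [ENNReal.tsum_mul_right, reachProb]
  have hzero : ∀ k, N < Γ.seed.card + k → ∀ A, Γ.reachProb P k A = 0 := by
    intro k hk A
    by_contra h0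
    obtain ⟨hp, hc⟩ := producible_of_reachProb_ne_zero P h0
    have := hN A hp
    omega
  have hsum : ∀ k, f Γ.seed =
      ∑' A, Γ.reachProb P k A * f A + ∑ j ∈ Finset.range k, Γ.reachProb P j A₀ := by
    intro k
    induction k with
    | zero =>
      simp only [reachProb, ite_mul, one_mul, zero_mul, Finset.range_zero, Finset.sum_empty,
        add_zero, tsum_ite_eq]
    | succ k ih => rw [ih, step k, Finset.sum_range_succ]; ring
  rw [termProb, hsum (N + 1), tsum_eq_sum (s := Finset.range (N + 1))]
  · have : ∀ A, Γ.reachProb P (N + 1) A * f A = 0 := fun A => by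
      rw [hzero (N + 1) (by omega) A, zero_mul]
    simp [this]
  · intro k hk
    rw [Finset.mem_range, not_lt] at hk
    exact hzero k (by omega) A₀

end General

end TileSystem

/-! ### The tile set of the coin tower -/

namespace CoinTower

/-- The kinds of tiles of the coin tower. -/
inductive Kind
  | relay | rightStart | leftStart | rightCheck | leftCheck | rightPost | leftPost | gate | launch
  deriving DecidableEq

instance : Fintype Kind where
  elems := {.relay, .rightStart, .leftStart, .rightCheck, .leftCheck, .rightPost, .leftPost, .gate,
    .launch}
  complete κ := by cases κ <;> decide

theorem card_kind : Fintype.card Kind = 9 := rfl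

/-- The glues of the coin tower. -/
inductive Glue
  | blank
  | leftArm (k : ℕ) | rightArm (k : ℕ) | floor (k : ℕ) | lift (k : ℕ) | checkLift (k : ℕ)
  | rightPillar (k : ℕ) | leftPillar (k : ℕ) | rightGate (k : ℕ) | leftGate (k : ℕ)
  | launchLift (k : ℕ)
  deriving DecidableEq

open Kind Glue

/-- The glue strengths; those of `checkLift` stop the growth at level `M`. -/
def strength (M : ℕ) : Glue → ℕ
  | blank => 0
  -- At level 0 no side relay lies below the check tile, so the arm of the seed must bind on its
  -- own. At higher levels the check tile binds cooperatively.
  | leftArm k => if k = 0 then 2 else 1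
  | rightArm k => if k = 0 then 2 else 1
  | floor _ => 1
  | lift _ => 2
  | checkLift k => if k < M then 1 else 0
  | rightPillar _ => 2
  | leftPillar _ => 2
  | rightGate _ => 1
  | leftGate _ => 1
  | launchLift _ => 2

def northGlue (k : ℕ) : Kind → Glue
  | relay => checkLift k
  -- Both possible coin tiles expose the same lift, so the next level does not depend on the result.
  | rightStart => lift (k + 1)
  | leftStart => lift (k + 1)
  | rightCheck => rightPillar k
  | leftCheck => leftPillar k
  | rightPost => floor k
  | leftPost => floor k
  | gate => launchLift k
  | launch => floor k

def eastGlue (k : ℕ) : Kind → Glue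
  | relay => rightArm k
  | rightStart => blank
  | leftStart => leftArm (k + 1)
  | rightCheck => blank
  | leftCheck => leftArm k
  | rightPost => blank
  | leftPost => leftGate k
  | gate => rightGate k
  | launch => rightArm (k + 1)

def southGlue (k : ℕ) : Kind → Glue
  | relay => lift k
  | rightStart => floor k
  | leftStart => floor k
  | rightCheck => checkLift k
  | leftCheck => checkLift k
  | rightPost => rightPillar k
  | leftPost => leftPillar k
  | gate => blank
  | launch => launchLift k

def westGlue (k : ℕ) : Kind → Glue
  | relay => leftArm k
  | rightStart => rightArm (k + 1)
  | leftStart => blank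
  | rightCheck => rightArm k
  | leftCheck => blank
  | rightPost => rightGate k
  | leftPost => blank
  | gate => leftGate k
  | launch => leftArm (k + 1)

/-- The tile types of the tower with `M` coins: a level and a kind. -/
abbrev Tile (M : ℕ) : Type := Fin (M + 1) × Kind

/-- The tile type of a given level and kind. -/
def tile (M k : ℕ) (κ : Kind) : Tile M := (Fin.ofNat (M + 1) k, κ)

/-- The tower of `M` coins: a strip of three columns. In the levels `4k` to `4k + 3`, the rows are,
from left to right, `leftCheck, relay, rightCheck`; `leftPost, gate, rightPost`;
`leftStart, launch, rightStart`; `relay, *, relay`, where `*` is the result of the `k`-th coin: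
`leftStart` if the right column reaches it first and `rightStart` if the left column does. -/
def tower (M : ℕ) : TileSystem Glue (Tile M) where
  strength := strength M
  north t := northGlue t.1 t.2
  east t := eastGlue t.1 t.2
  south t := southGlue t.1 t.2
  west t := westGlue t.1 t.2
  seed := {((0, 0), tile M 0 relay)}
  seed_coords := by simp
  temperature := 2
  temperature_pos := two_pos

def rightTile (M j : ℕ) : Tile M :=
  match j % 4 with
  | 0 => tile M (j / 4) rightCheck
  | 1 => tile M (j / 4) rightPost
  | 2 => tile M (j / 4) rightStart
  | _ => tile M (j / 4 + 1) relay

def leftTile (M j : ℕ) : Tile M :=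
  match j % 4 with
  | 0 => tile M (j / 4) leftCheck
  | 1 => tile M (j / 4) leftPost
  | 2 => tile M (j / 4) leftStart
  | _ => tile M (j / 4 + 1) relay

/-- The result of a coin. -/
def coinKind : Bool → Kind
  | true => leftStart
  | false => rightStart

def midTile (M : ℕ) (β : ℕ → Bool) (j : ℕ) : Tile M :=
  match j % 4 with
  | 0 => tile M (j / 4) relay
  | 1 => tile M (j / 4) gate
  | 2 => tile M (j / 4) launch
  | _ => tile M (j / 4) (coinKind (β (j / 4)))

section tiles

variable (M : ℕ) (β : ℕ → Bool) (k : ℕ)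

theorem rightTile_zero : rightTile M (4 * k) = tile M k rightCheck := by
  rw [rightTile, show 4 * k % 4 = 0 by omega, show 4 * k / 4 = k by omega]; rfl
theorem rightTile_one : rightTile M (4 * k + 1) = tile M k rightPost := by
  rw [rightTile, show (4 * k + 1) % 4 = 1 by omega, show (4 * k + 1) / 4 = k by omega]; rfl
theorem rightTile_two : rightTile M (4 * k + 2) = tile M k rightStart := by
  rw [rightTile, show (4 * k + 2) % 4 = 2 by omega, show (4 * k + 2) / 4 = k by omega]; rfl
theorem rightTile_three : rightTile M (4 * k + 3) = tile M (k + 1) relay := by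
  rw [rightTile, show (4 * k + 3) % 4 = 3 by omega, show (4 * k + 3) / 4 = k by omega]; rfl
theorem leftTile_zero : leftTile M (4 * k) = tile M k leftCheck := by
  rw [leftTile, show 4 * k % 4 = 0 by omega, show 4 * k / 4 = k by omega]; rfl
theorem leftTile_one : leftTile M (4 * k + 1) = tile M k leftPost := by
  rw [leftTile, show (4 * k + 1) % 4 = 1 by omega, show (4 * k + 1) / 4 = k by omega]; rfl
theorem leftTile_two : leftTile M (4 * k + 2) = tile M k leftStart := by
  rw [leftTile, show (4 * k + 2) % 4 = 2 by omega, show (4 * k + 2) / 4 = k by omega]; rfl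
theorem leftTile_three : leftTile M (4 * k + 3) = tile M (k + 1) relay := by
  rw [leftTile, show (4 * k + 3) % 4 = 3 by omega, show (4 * k + 3) / 4 = k by omega]; rfl
theorem midTile_zero : midTile M β (4 * k) = tile M k relay := by
  rw [midTile, show 4 * k % 4 = 0 by omega, show 4 * k / 4 = k by omega]; rfl
theorem midTile_one : midTile M β (4 * k + 1) = tile M k gate := by
  rw [midTile, show (4 * k + 1) % 4 = 1 by omega, show (4 * k + 1) / 4 = k by omega]; rfl
theorem midTile_two : midTile M β (4 * k + 2) = tile M k launch := by
  rw [midTile, show (4 * k + 2) % 4 = 2 by omega, show (4 * k + 2) / 4 = k by omega]; rfl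
theorem midTile_three : midTile M β (4 * k + 3) = tile M k (coinKind (β k)) := by
  rw [midTile, show (4 * k + 3) % 4 = 3 by omega, show (4 * k + 3) / 4 = k by omega]; rfl

variable {M k} in
theorem tile_fst (h : k ≤ M) (κ : Kind) : ((tile M k κ).1 : ℕ) = k := by
  simp [tile, Nat.mod_eq_of_lt (Nat.lt_succ_of_le h)]

theorem tile_snd (κ : Kind) : (tile M k κ).2 = κ := rfl

variable {M k} in
theorem eq_tile_iff (h : k ≤ M) (t : Tile M) (κ : Kind) :
    t = tile M k κ ↔ (t.1 : ℕ) = k ∧ t.2 = κ := by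
  rw [Prod.ext_iff, Fin.ext_iff, tile_fst h, tile_snd]

end tiles

/-! ### Assemblies made of three columns -/

/-- The assembly with column heights `L`, `N`, `R` and coin results `β`. -/
def asm (M L N R : ℕ) (β : ℕ → Bool) : Assembly (Tile M) :=
  (Finset.range L).image (fun j : ℕ => (((-1 : ℤ), (j : ℤ)), leftTile M j)) ∪
  (Finset.range N).image (fun j : ℕ => (((0 : ℤ), (j : ℤ)), midTile M β j)) ∪
  (Finset.range R).image (fun j : ℕ => (((1 : ℤ), (j : ℤ)), rightTile M j))

/-- The tile at a given position. -/
def occ (M L N R : ℕ) (β : ℕ → Bool) (x y : ℤ) : Option (Tile M) :=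
  if x = -1 ∧ 0 ≤ y ∧ y < L then some (leftTile M y.toNat)
  else if x = 0 ∧ 0 ≤ y ∧ y < N then some (midTile M β y.toNat)
  else if x = 1 ∧ 0 ≤ y ∧ y < R then some (rightTile M y.toNat)
  else none

variable {M L N R : ℕ} {β : ℕ → Bool}

theorem mem_asm {x y : ℤ} {t : Tile M} :
    ((x, y), t) ∈ asm M L N R β ↔ occ M L N R β x y = some t := by
  simp only [asm, Finset.mem_union, Finset.mem_image, Finset.mem_range, Prod.mk.injEq, occ]
  constructor
  · rintro ((⟨j, hj, ⟨rfl, rfl⟩, rfl⟩ | ⟨j, hj, ⟨rfl, rfl⟩, rfl⟩) | ⟨j, hj, ⟨rfl, rfl⟩, rfl⟩) <;>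
      simp [hj]
  · split_ifs with h1 h2 h3
    · rintro h
      exact .inl (.inl ⟨y.toNat, by omega, ⟨h1.1.symm, by omega⟩, by simpa using h⟩)
    · rintro h
      exact .inl (.inr ⟨y.toNat, by omega, ⟨h2.1.symm, by omega⟩, by simpa using h⟩)
    · rintro h
      exact .inr ⟨y.toNat, by omega, ⟨h3.1.symm, by omega⟩, by simpa using h⟩
    · simp

theorem sum_ite_coord (x y : ℤ) (g : Tile M → ℕ) :
    ∑ a ∈ asm M L N R β, (if a.1 = (x, y) then g a.2 else 0) =
      (occ M L N R β x y).elim 0 g := by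
  cases h : occ M L N R β x y with
  | none =>
    refine Finset.sum_eq_zero ?_
    rintro ⟨⟨x', y'⟩, t⟩ ha
    rw [mem_asm] at ha
    refine if_neg fun e => ?_
    simp only [Prod.mk.injEq] at e
    rw [e.1, e.2, h] at ha
    simp at ha
  | some t =>
    rw [Finset.sum_eq_single ((x, y), t)]
    · simp
    · rintro ⟨⟨x', y'⟩, t'⟩ ha hne
      rw [mem_asm] at ha
      refine if_neg fun e => hne ?_
      simp only [Prod.mk.injEq] at e
      rw [e.1, e.2, h] at ha
      simp [e.1, e.2, (Option.some.inj ha)]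
    · intro ha
      exact absurd (mem_asm.2 h) ha

/-- The strength of the bond of two glues. -/
def glueBond (M : ℕ) (g g' : Glue) : ℕ := if g = g' then strength M g else 0

theorem sum_bond (x y : ℤ) (t : Tile M) :
    ∑ a ∈ asm M L N R β, (tower M).bond ((x, y), t) a =
      (occ M L N R β x (y + 1)).elim 0
        (fun s => glueBond M (northGlue t.1 t.2) (southGlue s.1 s.2)) +
      (occ M L N R β (x + 1) y).elim 0
        (fun s => glueBond M (eastGlue t.1 t.2) (westGlue s.1 s.2)) +
      (occ M L N R β x (y - 1)).elim 0
        (fun s => glueBond M (southGlue t.1 t.2) (northGlue s.1 s.2)) +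
      (occ M L N R β (x - 1) y).elim 0
        (fun s => glueBond M (westGlue t.1 t.2) (eastGlue s.1 s.2)) := by
  simp only [TileSystem.bond_eq_sum, Finset.sum_add_distrib, Prod.mk_add_mk, add_zero,
    ← sub_eq_add_neg, ← sum_ite_coord]
  rfl

/-- The column heights of the producible assemblies. -/
structure Valid (M L N R : ℕ) : Prop where
  left_le : L ≤ 4 * M
  right_le : R ≤ 4 * M
  mid_pos : 1 ≤ N
  mid_le : N ≤ 4 * M + 1
  -- In a side column an even row needs the middle tile beside it, while an odd row is held by a
  -- strength 2 bond from below.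
  left_cap : L ≤ 2 * ((N + 1) / 2)
  right_cap : R ≤ 2 * ((N + 1) / 2)
  -- The gate in row `4 * k + 1` binds only to the posts on both sides, so both columns have reached
  -- that row before it is placed.
  gate_left : ∀ k, 4 * k + 2 ≤ N → 4 * k + 2 ≤ L
  gate_right : ∀ k, 4 * k + 2 ≤ N → 4 * k + 2 ≤ R
  -- The coin tile in row `4 * k + 3` needs the relay of one side column next to it.
  coin : ∀ k, 4 * k + 4 ≤ N → 4 * k + 4 ≤ L ∨ 4 * k + 4 ≤ R

section occ

theorem occ_right (j : ℕ) : occ M L N R β 1 j = if j < R then some (rightTile M j) else none := by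
  simp [occ]
theorem occ_left (j : ℕ) : occ M L N R β (-1) j = if j < L then some (leftTile M j) else none := by
  simp [occ]
theorem occ_mid (j : ℕ) : occ M L N R β 0 j = if j < N then some (midTile M β j) else none := by
  simp [occ]
theorem occ_neg (x y : ℤ) (h : y < 0) : occ M L N R β x y = none := by
  simp [occ, not_le.2 h]
theorem occ_out (x y : ℤ) (h : x < -1 ∨ 1 < x) : occ M L N R β x y = none := by
  rw [occ, if_neg (by omega), if_neg (by omega), if_neg (by omega)]

end occ

/-! ### Binding strengths, position by position -/

/-- The total strength with which `t` binds at the position `(x, y)`. -/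
def weight (M L N R : ℕ) (β : ℕ → Bool) (x y : ℤ) (t : Tile M) : ℕ :=
  ∑ a ∈ asm M L N R β, (tower M).bond ((x, y), t) a

theorem glueBond_le_one {g g' : Glue} (h : strength M g' ≤ 1) : glueBond M g g' ≤ 1 := by
  unfold glueBond
  split_ifs with e
  · rwa [e]
  · exact zero_le_one

/-- Above the first free row only the middle neighbour remains, and its east glue has strength at
most 1; the exceptional strength 2 occurs only in row 0. -/
theorem weight_right_gt (hv : Valid M L N R) (j : ℕ) (hj : R < j) (t : Tile M) :
    weight M L N R β 1 j t < 2 := by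
  rw [weight, sum_bond]
  have h1 := occ_right (M := M) (L := L) (N := N) (R := R) (β := β) (j + 1)
  have h2 := occ_right (M := M) (L := L) (N := N) (R := R) (β := β) (j - 1)
  push_cast [show 1 ≤ j by omega] at h1 h2
  rw [h1, h2, if_neg (by omega), if_neg (by omega), occ_out _ _ (by omega), sub_self, occ_mid]
  simp only [Option.elim_none, zero_add]
  split_ifs with h
  · simp only [Option.elim_some]
    refine Nat.lt_succ_of_le (glueBond_le_one ?_)
    obtain ⟨k, r, hr, rfl⟩ : ∃ k r, r < 4 ∧ j = 4 * k + r := ⟨j / 4, j % 4, by omega, by omega⟩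
    have := hv.mid_le
    interval_cases r
    · rw [add_zero, midTile_zero, tile_fst (by omega), tile_snd]
      simp [eastGlue, strength, show k ≠ 0 by omega]
    · rw [midTile_one, tile_fst (by omega), tile_snd]
      simp [eastGlue, strength]
    · rw [midTile_two, tile_fst (by omega), tile_snd]
      simp [eastGlue, strength]
    · rw [midTile_three, tile_fst (by omega), tile_snd]
      cases β k <;> simp [coinKind, eastGlue, strength]
  · simp

/-- Even rows bind to the tile below and to the middle tile with strength 1 each, except that row 0
binds to the seed alone; odd rows bind below with strength 2. Growth stops at `4 * M` because
`checkLift M` has strength 0 and, as `M > 0`, the arm there has strength only 1. -/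
theorem weight_right (hM : 0 < M) (hv : Valid M L N R) (t : Tile M) :
    2 ≤ weight M L N R β 1 R t ↔ t = rightTile M R ∧ R < 4 * M ∧ R < 2 * ((N + 1) / 2) := by
  rw [weight, sum_bond]
  have h1 := occ_right (M := M) (L := L) (N := N) (R := R) (β := β) (R + 1)
  have h2 := occ_right (M := M) (L := L) (N := N) (R := R) (β := β) (R - 1)
  push_cast at h1
  rw [h1, if_neg (by omega), occ_out _ _ (by omega), sub_self, occ_mid]
  simp only [Option.elim_none, zero_add]
  obtain ⟨i, κ⟩ := t
  obtain ⟨hL, hR, hN1, hN, hcl, hcr, hgl, hgr, hc⟩ := hv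
  rcases Nat.eq_zero_or_pos R with rfl | hpos
  · rw [occ_neg _ _ (by simp), if_pos (by omega), midTile_zero M β 0, rightTile_zero M 0, eq_tile_iff (by omega)]
    simp only [Option.elim_none, Option.elim_some, tile_fst (Nat.zero_le M), tile_snd, zero_add, show 0 < 4 * M by omega, show 0 < 2 * ((N + 1) / 2) by omega, and_true]
    cases κ <;> simp [glueBond, westGlue, eastGlue, strength] <;> grind
  · push_cast [show 1 ≤ R by omega] at h2
    rw [h2, if_pos (by omega)]
    obtain ⟨k, r, hr, rfl⟩ : ∃ k r, r < 4 ∧ R = 4 * k + r := ⟨R / 4, R % 4, by omega, by omega⟩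
    interval_cases r
    · obtain ⟨k, rfl⟩ : ∃ k', k = k' + 1 := ⟨k - 1, by omega⟩
      rw [show 4 * (k + 1) + 0 - 1 = 4 * k + 3 by omega, add_zero, rightTile_three, rightTile_zero, midTile_zero, eq_tile_iff (by omega)]
      by_cases h : 4 * (k + 1) < N
      · rw [if_pos h]
        simp only [Option.elim_some, tile_fst (show k + 1 ≤ M by omega), tile_snd]
        by_cases h' : k + 1 < M
        · cases κ <;> simp [glueBond, westGlue, eastGlue, northGlue, southGlue, strength, h'] <;>
            grind
        · cases κ <;> simp [glueBond, westGlue, eastGlue, northGlue, southGlue, strength, h'] <;>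
            grind
      · rw [if_neg h]
        simp only [Option.elim_some, Option.elim_none, tile_fst (show k + 1 ≤ M by omega), tile_snd]
        cases κ <;> simp [glueBond, westGlue, eastGlue, northGlue, southGlue, strength] <;>
            grind
    · rw [show 4 * k + 1 - 1 = 4 * k by omega, rightTile_zero, rightTile_one, midTile_one,
        eq_tile_iff (by omega)]
      simp only [Option.elim_some, tile_fst (show k ≤ M by omega), tile_snd]
      split_ifs <;>
        simp only [Option.elim_some, Option.elim_none, tile_fst (show k ≤ M by omega), tile_snd] <;>
        cases κ <;> simp [glueBond, westGlue, eastGlue, northGlue, southGlue, strength] <;> grind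
    · rw [show 4 * k + 2 - 1 = 4 * k + 1 by omega, rightTile_one, rightTile_two, midTile_two,
        eq_tile_iff (by omega)]
      simp only [Option.elim_some, tile_fst (show k ≤ M by omega), tile_snd]
      split_ifs <;>
        simp only [Option.elim_some, Option.elim_none, tile_fst (show k ≤ M by omega), tile_snd] <;>
        cases κ <;> simp [glueBond, westGlue, eastGlue, northGlue, southGlue, strength] <;> grind
    · rw [show 4 * k + 3 - 1 = 4 * k + 2 by omega, rightTile_two, rightTile_three, midTile_three,
        eq_tile_iff (by omega)]
      simp only [Option.elim_some, tile_fst (show k ≤ M by omega), tile_snd]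
      split_ifs <;>
        simp only [Option.elim_some, Option.elim_none, tile_fst (show k ≤ M by omega), tile_snd] <;>
        cases β k <;> cases κ <;>
        simp [coinKind, glueBond, westGlue, eastGlue, northGlue, southGlue, strength] <;> grind

theorem weight_left_gt (hv : Valid M L N R) (j : ℕ) (hj : L < j) (t : Tile M) :
    weight M L N R β (-1) j t < 2 := by
  rw [weight, sum_bond]
  have h1 := occ_left (M := M) (L := L) (N := N) (R := R) (β := β) (j + 1)
  have h2 := occ_left (M := M) (L := L) (N := N) (R := R) (β := β) (j - 1)
  push_cast [show 1 ≤ j by omega] at h1 h2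
  rw [h1, h2, if_neg (by omega), if_neg (by omega), occ_out (-1 - 1) _ (by omega), show (-1 : ℤ) + 1 = 0 from rfl, occ_mid]
  simp only [Option.elim_none, zero_add, add_zero]
  split_ifs with h
  · simp only [Option.elim_some]
    refine Nat.lt_succ_of_le (glueBond_le_one ?_)
    obtain ⟨k, r, hr, rfl⟩ : ∃ k r, r < 4 ∧ j = 4 * k + r := ⟨j / 4, j % 4, by omega, by omega⟩
    have := hv.mid_le
    interval_cases r
    · rw [add_zero, midTile_zero, tile_fst (by omega), tile_snd]
      simp [westGlue, strength, show k ≠ 0 by omega]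
    · rw [midTile_one, tile_fst (by omega), tile_snd]
      simp [westGlue, strength]
    · rw [midTile_two, tile_fst (by omega), tile_snd]
      simp [westGlue, strength]
    · rw [midTile_three, tile_fst (by omega), tile_snd]
      cases β k <;> simp [coinKind, westGlue, strength]
  · simp

theorem weight_left (hM : 0 < M) (hv : Valid M L N R) (t : Tile M) :
    2 ≤ weight M L N R β (-1) L t ↔ t = leftTile M L ∧ L < 4 * M ∧ L < 2 * ((N + 1) / 2) := by
  rw [weight, sum_bond]
  have h1 := occ_left (M := M) (L := L) (N := N) (R := R) (β := β) (L + 1)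
  have h2 := occ_left (M := M) (L := L) (N := N) (R := R) (β := β) (L - 1)
  push_cast at h1
  rw [h1, if_neg (by omega), occ_out (-1 - 1) _ (by omega), show (-1 : ℤ) + 1 = 0 from rfl, occ_mid]
  simp only [Option.elim_none, zero_add, add_zero]
  obtain ⟨i, κ⟩ := t
  obtain ⟨hL, hR, hN1, hN, hcl, hcr, hgl, hgr, hc⟩ := hv
  rcases Nat.eq_zero_or_pos L with rfl | hpos
  · rw [occ_neg _ _ (by simp), if_pos (by omega), midTile_zero M β 0, leftTile_zero M 0, eq_tile_iff (by omega)]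
    simp only [Option.elim_none, Option.elim_some, tile_fst (Nat.zero_le M), tile_snd, zero_add, show 0 < 4 * M by omega, show 0 < 2 * ((N + 1) / 2) by omega, and_true]
    cases κ <;> simp [glueBond, westGlue, eastGlue, strength] <;> grind
  · push_cast [show 1 ≤ L by omega] at h2
    rw [h2, if_pos (show L - 1 < L by omega)]
    obtain ⟨k, r, hr, rfl⟩ : ∃ k r, r < 4 ∧ L = 4 * k + r := ⟨L / 4, L % 4, by omega, by omega⟩
    interval_cases r
    · obtain ⟨k, rfl⟩ : ∃ k', k = k' + 1 := ⟨k - 1, by omega⟩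
      rw [show 4 * (k + 1) + 0 - 1 = 4 * k + 3 by omega, add_zero, leftTile_three, leftTile_zero, midTile_zero, eq_tile_iff (by omega)]
      by_cases h : 4 * (k + 1) < N
      · rw [if_pos h]
        simp only [Option.elim_some, tile_fst (show k + 1 ≤ M by omega), tile_snd]
        by_cases h' : k + 1 < M
        · cases κ <;> simp [glueBond, westGlue, eastGlue, northGlue, southGlue, strength, h'] <;>
            grind
        · cases κ <;> simp [glueBond, westGlue, eastGlue, northGlue, southGlue, strength, h'] <;>
            grind
      · rw [if_neg h]
        simp only [Option.elim_some, Option.elim_none, tile_fst (show k + 1 ≤ M by omega), tile_snd]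
        cases κ <;> simp [glueBond, westGlue, eastGlue, northGlue, southGlue, strength] <;>
            grind
    · rw [show 4 * k + 1 - 1 = 4 * k by omega, leftTile_zero, leftTile_one, midTile_one,
        eq_tile_iff (by omega)]
      simp only [Option.elim_some, tile_fst (show k ≤ M by omega), tile_snd]
      split_ifs <;>
        simp only [Option.elim_some, Option.elim_none, tile_fst (show k ≤ M by omega), tile_snd] <;>
        cases κ <;> simp [glueBond, westGlue, eastGlue, northGlue, southGlue, strength] <;> grind
    · rw [show 4 * k + 2 - 1 = 4 * k + 1 by omega, leftTile_one, leftTile_two, midTile_two,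
        eq_tile_iff (by omega)]
      simp only [Option.elim_some, tile_fst (show k ≤ M by omega), tile_snd]
      split_ifs <;>
        simp only [Option.elim_some, Option.elim_none, tile_fst (show k ≤ M by omega), tile_snd] <;>
        cases κ <;> simp [glueBond, westGlue, eastGlue, northGlue, southGlue, strength] <;> grind
    · rw [show 4 * k + 3 - 1 = 4 * k + 2 by omega, leftTile_two, leftTile_three, midTile_three,
        eq_tile_iff (by omega)]
      simp only [Option.elim_some, tile_fst (show k ≤ M by omega), tile_snd]
      split_ifs <;>
        simp only [Option.elim_some, Option.elim_none, tile_fst (show k ≤ M by omega), tile_snd] <;>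
        cases β k <;> cases κ <;>
        simp [coinKind, glueBond, westGlue, eastGlue, northGlue, southGlue, strength] <;> grind

/-- The caps keep the side columns at height at most `N + 1`, so all four neighbouring positions are
empty. -/
theorem weight_mid_gt (hv : Valid M L N R) (j : ℕ) (hj : N < j) (t : Tile M) :
    weight M L N R β 0 j t < 2 := by
  rw [weight, sum_bond]
  have h1 := occ_mid (M := M) (L := L) (N := N) (R := R) (β := β) (j + 1)
  have h2 := occ_mid (M := M) (L := L) (N := N) (R := R) (β := β) (j - 1)
  push_cast [show 1 ≤ j by omega] at h1 h2
  have := hv.left_cap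
  have := hv.right_cap
  rw [h1, h2, if_neg (by omega), if_neg (by omega), zero_add, zero_sub, occ_left, occ_right,
    if_neg (by omega), if_neg (by omega)]
  simp

/-- The residue of `N` modulo 4 selects the mechanism: relay and launch bind below with strength 2,
the gate binds to both posts, and the coin tile binds to the launch tile and to one side relay. Only
the coin row admits two tile types. -/
theorem weight_mid (hv : Valid M L N R) (t : Tile M) :
    2 ≤ weight M L N R β 0 N t ↔
      ((N % 4 = 0 ∨ N % 4 = 2 ∨ N % 4 = 1 ∧ N < L ∧ N < R) ∧ t = midTile M β N) ∨
      (N % 4 = 3 ∧ N < R ∧ t = tile M (N / 4) leftStart) ∨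
      (N % 4 = 3 ∧ N < L ∧ t = tile M (N / 4) rightStart) := by
  rw [weight, sum_bond]
  have h1 := occ_mid (M := M) (L := L) (N := N) (R := R) (β := β) (N + 1)
  have h2 := occ_mid (M := M) (L := L) (N := N) (R := R) (β := β) (N - 1)
  obtain ⟨i, κ⟩ := t
  obtain ⟨hL, hR, hN1, hN, hcl, hcr, hgl, hgr, hc⟩ := hv
  push_cast [hN1] at h1 h2
  rw [h1, h2, if_neg (by omega), if_pos (by omega), zero_add, zero_sub, occ_left, occ_right]
  simp only [Option.elim_none, zero_add]
  obtain ⟨k, r, hr, rfl⟩ : ∃ k r, r < 4 ∧ N = 4 * k + r := ⟨N / 4, N % 4, by omega, by omega⟩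
  interval_cases r
  · obtain ⟨k, rfl⟩ : ∃ k', k = k' + 1 := ⟨k - 1, by omega⟩
    rw [show 4 * (k + 1) + 0 - 1 = 4 * k + 3 by omega, if_neg (by omega), if_neg (by omega),
      midTile_three, add_zero, midTile_zero, eq_tile_iff (by omega),
      show 4 * (k + 1) % 4 = 0 by omega]
    simp only [Option.elim_some, Option.elim_none, tile_fst (show k ≤ M by omega), tile_snd]
    cases β k <;> cases κ <;>
      simp [coinKind, glueBond, westGlue, eastGlue, northGlue, southGlue, strength] <;> grind
  · rw [show 4 * k + 1 - 1 = 4 * k by omega, midTile_zero, midTile_one, rightTile_one,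
      leftTile_one, eq_tile_iff (by omega), show (4 * k + 1) % 4 = 1 by omega]
    split_ifs <;>
      simp only [Option.elim_some, Option.elim_none, tile_fst (show k ≤ M by omega), tile_snd] <;>
      cases κ <;>
      simp [glueBond, westGlue, eastGlue, northGlue, southGlue, strength, *] <;> grind
  · rw [show 4 * k + 2 - 1 = 4 * k + 1 by omega, if_neg (by omega), if_neg (by omega),
      midTile_one, midTile_two, eq_tile_iff (by omega), show (4 * k + 2) % 4 = 2 by omega]
    simp only [Option.elim_some, Option.elim_none, tile_fst (show k ≤ M by omega), tile_snd]
    cases κ <;>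
      simp [glueBond, westGlue, eastGlue, northGlue, southGlue, strength] <;> grind
  · rw [show 4 * k + 3 - 1 = 4 * k + 2 by omega, midTile_two, rightTile_three, leftTile_three,
      show (4 * k + 3) / 4 = k by omega, eq_tile_iff (by omega), eq_tile_iff (by omega),
      show (4 * k + 3) % 4 = 3 by omega]
    split_ifs <;>
      simp only [Option.elim_some, Option.elim_none, tile_fst (show k ≤ M by omega),
        tile_fst (show k + 1 ≤ M by omega), tile_snd] <;>
      cases κ <;>
      simp [glueBond, westGlue, eastGlue, northGlue, southGlue, strength, *] <;> grind

/-- The only strong glue facing down from row 0 is the `lift 0` of the seed, and no tile has this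
glue on its north edge. -/
theorem weight_neg (y : ℤ) (hy : y < 0) (x : ℤ) (t : Tile M) :
    weight M L N R β x y t < 2 := by
  rw [weight, sum_bond, occ_neg _ y hy, occ_neg _ y hy, occ_neg _ (y - 1) (by omega)]
  simp only [Option.elim_none, add_zero]
  rcases (show y + 1 < 0 ∨ y + 1 = 0 by omega) with h | h
  · rw [occ_neg _ _ h]; simp
  · rw [h]
    by_cases hx : x < -1 ∨ 1 < x
    · rw [occ_out _ _ hx]; simp
    · obtain rfl | rfl | rfl : x = -1 ∨ x = 0 ∨ x = 1 := by omega
      · rw [← Nat.cast_zero, occ_left]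
        split_ifs
        · refine Nat.lt_succ_of_le (glueBond_le_one ?_)
          rw [leftTile_zero M 0]
          simp [tile_snd, southGlue, strength]; grind
        · simp
      · have h0 := occ_mid (M := M) (L := L) (N := N) (R := R) (β := β) 0
        rw [Nat.cast_zero] at h0
        rw [h0]
        split_ifs
        · obtain ⟨i, κ⟩ := t
          rw [midTile_zero M β 0]
          simp only [Option.elim_some, tile_fst (Nat.zero_le M), tile_snd]
          cases κ <;> simp [glueBond, northGlue, southGlue]
        · simp
      · rw [← Nat.cast_zero, occ_right]
        split_ifs
        · refine Nat.lt_succ_of_le (glueBond_le_one ?_)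
          rw [rightTile_zero M 0]
          simp [tile_snd, southGlue, strength]; grind
        · simp

theorem weight_out (hv : Valid M L N R) (j : ℕ) (x : ℤ) (hx : x < -1 ∨ 1 < x) (t : Tile M) :
    weight M L N R β x j t < 2 := by
  rw [weight, sum_bond, occ_out x _ hx, occ_out x _ hx]
  obtain ⟨hL, hR, hN1, hN, hcl, hcr, hgl, hgr, hc⟩ := hv
  simp only [Option.elim_none, zero_add, add_zero]
  rcases hx with hx | hx
  · rw [occ_out (x - 1) _ (by omega)]
    simp only [Option.elim_none, add_zero]
    rcases (show x + 1 < -1 ∨ x + 1 = -1 by omega) with h | h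
    · rw [occ_out _ _ (.inl h)]; simp
    · rw [h, occ_left]
      split_ifs with hj
      · refine Nat.lt_succ_of_le (glueBond_le_one ?_)
        obtain ⟨k, r, hr, rfl⟩ : ∃ k r, r < 4 ∧ j = 4 * k + r := ⟨j / 4, j % 4, by omega, by omega⟩
        interval_cases r
        · rw [add_zero, leftTile_zero]; simp [tile_snd, westGlue, strength]
        · rw [leftTile_one]; simp [tile_snd, westGlue, strength]
        · rw [leftTile_two]; simp [tile_snd, westGlue, strength]
        · rw [leftTile_three, tile_fst (by omega)]; simp [tile_snd, westGlue, strength]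
      · simp
  · rw [occ_out (x + 1) _ (by omega)]
    simp only [Option.elim_none, zero_add]
    rcases (show 1 < x - 1 ∨ x - 1 = 1 by omega) with h | h
    · rw [occ_out _ _ (.inr h)]; simp
    · rw [h, occ_right]
      split_ifs with hj
      · refine Nat.lt_succ_of_le (glueBond_le_one ?_)
        obtain ⟨k, r, hr, rfl⟩ : ∃ k r, r < 4 ∧ j = 4 * k + r := ⟨j / 4, j % 4, by omega, by omega⟩
        interval_cases r
        · rw [add_zero, rightTile_zero]; simp [tile_snd, eastGlue, strength]
        · rw [rightTile_one]; simp [tile_snd, eastGlue, strength]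
        · rw [rightTile_two]; simp [tile_snd, eastGlue, strength]
        · rw [rightTile_three, tile_fst (by omega)]; simp [tile_snd, eastGlue, strength]
      · simp

end CoinTower

/-! ### Frontier, producible assemblies and extensibility -/

namespace CoinTower

open Kind Glue TileSystem

variable {M L N R : ℕ} {β : ℕ → Bool}

/-- The right column can grow. -/
def RightGrows (M N R : ℕ) : Prop := R < 4 * M ∧ R < 2 * ((N + 1) / 2)

/-- The middle column can grow, by a tile of type `t`. -/
def MidGrows (M L N R : ℕ) (β : ℕ → Bool) (t : Tile M) : Prop :=
  ((N % 4 = 0 ∨ N % 4 = 2 ∨ N % 4 = 1 ∧ N < L ∧ N < R) ∧ t = midTile M β N) ∨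
  (N % 4 = 3 ∧ N < R ∧ t = tile M (N / 4) leftStart) ∨
  (N % 4 = 3 ∧ N < L ∧ t = tile M (N / 4) rightStart)

theorem mem_frontier (hM : 0 < M) (hv : Valid M L N R) (hp : (tower M).Producible (asm M L N R β))
    (x y : ℤ) (t : Tile M) :
    ((x, y), t) ∈ (tower M).frontier (asm M L N R β) ↔
      (x = 1 ∧ y = R ∧ t = rightTile M R ∧ RightGrows M N R) ∨
      (x = -1 ∧ y = L ∧ t = leftTile M L ∧ RightGrows M N L) ∨
      (x = 0 ∧ y = N ∧ MidGrows M L N R β t) := by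
  rw [mem_frontier_iff (Finset.card_singleton _) hp]
  have hocc : (∀ a ∈ asm M L N R β, a.1 ≠ (x, y)) ↔ occ M L N R β x y = none := by
    constructor
    · intro h
      by_contra hne
      obtain ⟨s, hs⟩ := Option.ne_none_iff_exists'.1 hne
      exact h _ (mem_asm.2 hs) rfl
    · rintro h ⟨⟨x', y'⟩, s⟩ ha e
      simp only [Prod.mk.injEq] at e
      rw [mem_asm, e.1, e.2, h] at ha
      simp at ha
  simp only [hocc]
  constructor
  · rintro ⟨h0, hw⟩
    have hw : 2 ≤ weight M L N R β x y t := hw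
    rcases lt_or_ge y 0 with hy | hy
    · exact absurd hw (not_le.2 (weight_neg y hy x t))
    lift y to ℕ using hy with j
    by_cases hx : x < -1 ∨ 1 < x
    · exact absurd hw (not_le.2 (weight_out hv j x hx t))
    obtain rfl | rfl | rfl : x = -1 ∨ x = 0 ∨ x = 1 := by omega
    · rw [occ_left] at h0
      have hj : L ≤ j := by by_contra h; simp [not_le.1 h] at h0
      rcases hj.eq_or_lt with rfl | hj
      · rw [weight_left hM hv] at hw
        exact .inr (.inl ⟨rfl, rfl, hw⟩)
      · exact absurd hw (not_le.2 (weight_left_gt hv j hj t))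
    · rw [occ_mid] at h0
      have hj : N ≤ j := by by_contra h; simp [not_le.1 h] at h0
      rcases hj.eq_or_lt with rfl | hj
      · rw [weight_mid hv] at hw
        exact .inr (.inr ⟨rfl, rfl, hw⟩)
      · exact absurd hw (not_le.2 (weight_mid_gt hv j hj t))
    · rw [occ_right] at h0
      have hj : R ≤ j := by by_contra h; simp [not_le.1 h] at h0
      rcases hj.eq_or_lt with rfl | hj
      · rw [weight_right hM hv] at hw
        exact .inl ⟨rfl, rfl, hw⟩
      · exact absurd hw (not_le.2 (weight_right_gt hv j hj t))
  · rintro (⟨rfl, rfl, h⟩ | ⟨rfl, rfl, h⟩ | ⟨rfl, rfl, h⟩)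
    · exact ⟨by rw [occ_right, if_neg (lt_irrefl _)], (weight_right hM hv t).2 h⟩
    · exact ⟨by rw [occ_left, if_neg (lt_irrefl _)], (weight_left hM hv t).2 h⟩
    · exact ⟨by rw [occ_mid, if_neg (lt_irrefl _)], (weight_mid hv t).2 h⟩

theorem insert_right :
    insert ((1, (R : ℤ)), rightTile M R) (asm M L N R β) = asm M L N (R + 1) β := by
  simp only [asm, Finset.range_add_one (n := R), Finset.image_insert, Finset.union_insert]

theorem insert_left :
    insert ((-1, (L : ℤ)), leftTile M L) (asm M L N R β) = asm M (L + 1) N R β := by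
  simp only [asm, Finset.range_add_one (n := L), Finset.image_insert, Finset.insert_union]

theorem insert_mid :
    insert ((0, (N : ℤ)), midTile M β N) (asm M L N R β) = asm M L (N + 1) R β := by
  simp only [asm, Finset.range_add_one (n := N), Finset.image_insert, Finset.union_insert,
    Finset.insert_union]

/-- The `k`-th result is visible only in row `4 * k + 3` of the middle column, so later values of
`β` are free. -/
theorem asm_congr {β' : ℕ → Bool} (h : ∀ k < N / 4, β k = β' k) :
    asm M L N R β = asm M L N R β' := by
  have : ∀ j ∈ Finset.range N, (((0 : ℤ), (j : ℤ)), midTile M β j) =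
      (((0 : ℤ), (j : ℤ)), midTile M β' j) := by
    intro j hj
    rw [Finset.mem_range] at hj
    congr 1
    obtain ⟨k, r, hr, rfl⟩ : ∃ k r, r < 4 ∧ j = 4 * k + r := ⟨j / 4, j % 4, by omega, by omega⟩
    interval_cases r
    · rw [add_zero, midTile_zero, midTile_zero]
    · rw [midTile_one, midTile_one]
    · rw [midTile_two, midTile_two]
    · rw [midTile_three, midTile_three, h k (by omega)]
  unfold asm
  rw [Finset.image_congr (fun j hj => this j hj)]

theorem insert_coin (h : N % 4 = 3) (o : Bool) :
    insert ((0, (N : ℤ)), tile M (N / 4) (coinKind o)) (asm M L N R β) =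
      asm M L (N + 1) R (Function.update β (N / 4) o) := by
  rw [← insert_mid, asm_congr (β := β) (β' := Function.update β (N / 4) o)]
  · congr 2
    obtain ⟨k, rfl⟩ : ∃ k, N = 4 * k + 3 := ⟨N / 4, by omega⟩
    rw [midTile_three, show (4 * k + 3) / 4 = k by omega, Function.update_self]
  · intro k hk
    rw [Function.update_of_ne hk.ne]

theorem Valid.right (hv : Valid M L N R) (h : RightGrows M N R) : Valid M L N (R + 1) := by
  obtain ⟨hL, hR, hN1, hN, hcl, hcr, hgl, hgr, hc⟩ := hv
  obtain ⟨h1, h2⟩ := h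
  refine ⟨hL, by omega, hN1, hN, hcl, by omega, hgl, fun k hk => ?_, fun k hk => ?_⟩
  · have := hgr k hk; omega
  · have := hc k hk; omega

theorem Valid.left (hv : Valid M L N R) (h : RightGrows M N L) : Valid M (L + 1) N R := by
  obtain ⟨hL, hR, hN1, hN, hcl, hcr, hgl, hgr, hc⟩ := hv
  obtain ⟨h1, h2⟩ := h
  refine ⟨by omega, hR, hN1, hN, by omega, hcr, fun k hk => ?_, hgr, fun k hk => ?_⟩
  · have := hgl k hk; omega
  · have := hc k hk; omega

theorem Valid.mid (hv : Valid M L N R) {t : Tile M} (h : MidGrows M L N R β t) :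
    Valid M L (N + 1) R := by
  obtain ⟨hL, hR, hN1, hN, hcl, hcr, hgl, hgr, hc⟩ := hv
  have h : N % 4 = 0 ∨ N % 4 = 2 ∨ (N % 4 = 1 ∧ N < L ∧ N < R) ∨
      (N % 4 = 3 ∧ (N < R ∨ N < L)) := by
    unfold MidGrows at h; tauto
  refine ⟨hL, hR, by omega, by omega, by omega, by omega, fun k hk => ?_, fun k hk => ?_,
    fun k hk => ?_⟩
  · rcases hk.lt_or_eq with hk | hk
    · exact hgl k (by omega)
    · omega
  · rcases hk.lt_or_eq with hk | hk
    · exact hgr k (by omega)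
    · omega
  · rcases hk.lt_or_eq with hk | hk
    · exact hc k (by omega)
    · omega

theorem seed_eq : (tower M).seed = asm M 0 1 0 β := by
  simp only [asm, Finset.range_zero, Finset.image_empty, Finset.empty_union, Finset.union_empty,
    Finset.range_one, Finset.image_singleton]
  rfl

theorem valid_seed : Valid M 0 1 0 := by
  constructor <;> intros <;> omega

theorem Producible.exists_asm (hM : 0 < M) {A : Assembly (Tile M)} (h : (tower M).Producible A) :
    ∃ L N R β, A = asm M L N R β ∧ Valid M L N R := by
  induction h with
  | seed => exact ⟨0, 1, 0, fun _ => true, seed_eq, valid_seed⟩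
  | attach hp h ih =>
    obtain ⟨L, N, R, β, rfl, hv⟩ := ih
    obtain ⟨⟨⟨x, y⟩, t⟩, hb, rfl⟩ := h
    rw [mem_frontier hM hv hp] at hb
    rcases hb with ⟨rfl, rfl, rfl, h⟩ | ⟨rfl, rfl, rfl, h⟩ | ⟨rfl, rfl, h⟩
    · exact ⟨_, _, _, _, insert_right, hv.right h⟩
    · exact ⟨_, _, _, _, insert_left, hv.left h⟩
    · have hv' := hv.mid h
      rcases h with ⟨_, rfl⟩ | ⟨h, _, rfl⟩ | ⟨h, _, rfl⟩
      · exact ⟨_, _, _, _, insert_mid, hv'⟩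
      · exact ⟨_, _, _, _, insert_coin h true, hv'⟩
      · exact ⟨_, _, _, _, insert_coin h false, hv'⟩

theorem card_asm_le : (asm M L N R β).card ≤ L + N + R := by
  refine (Finset.card_union_le _ _).trans (add_le_add ((Finset.card_union_le _ _).trans
    (add_le_add ?_ ?_)) ?_) <;>
  exact Finset.card_image_le.trans (Finset.card_range _).le

theorem card_le (hM : 0 < M) {A : Assembly (Tile M)} (h : (tower M).Producible A) :
    A.card ≤ 12 * M + 1 := by
  obtain ⟨L, N, R, β, rfl, hv⟩ := Producible.exists_asm hM h
  have := card_asm_le (M := M) (L := L) (N := N) (R := R) (β := β)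
  have := hv.left_le
  have := hv.right_le
  have := hv.mid_le
  omega

theorem space_le (hM : 0 < M) : (tower M).space ≤ (12 * M + 1 : ℕ) :=
  iSup₂_le fun _ hA => by exact_mod_cast card_le hM hA.1

theorem isExtensible (hM : 0 < M) : (tower M).IsExtensible 2 := by
  intro A hp
  obtain ⟨L, N, R, β, rfl, hv⟩ := Producible.exists_asm hM hp
  obtain ⟨p, q, hpq⟩ : ∃ p q : ℤ × ℤ, (tower M).locations (asm M L N R β) ⊆ {p, q} := by
    by_cases h1 : RightGrows M N R
    · by_cases h2 : RightGrows M N L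
      · refine ⟨(1, R), (-1, L), ?_⟩
        rintro _ ⟨⟨⟨x, y⟩, t⟩, hb, rfl⟩
        rw [mem_frontier hM hv hp] at hb
        rcases hb with ⟨rfl, rfl, -⟩ | ⟨rfl, rfl, -⟩ | ⟨rfl, rfl, h⟩
        · simp
        · simp
        -- The middle column can advance only when some side column is at its cap: by `coin` if `N %
        -- 4 = 0`, by the gates if `N % 4 = 2`, and by the attachment condition itself in the odd
        -- cases. So three locations are never open at once.
        · exfalso
          have h : N % 4 = 0 ∨ N % 4 = 2 ∨ (N % 4 = 1 ∧ N < L ∧ N < R) ∨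
              (N % 4 = 3 ∧ (N < R ∨ N < L)) := by
            unfold MidGrows at h; tauto
          obtain ⟨hL, hR, hN1, hN, hcl, hcr, hgl, hgr, hc⟩ := hv
          have := hc (N / 4 - 1)
          have := hgr (N / 4)
          unfold RightGrows at h1 h2
          omega
      · refine ⟨(1, R), (0, N), ?_⟩
        rintro _ ⟨⟨⟨x, y⟩, t⟩, hb, rfl⟩
        rw [mem_frontier hM hv hp] at hb
        rcases hb with ⟨rfl, rfl, -⟩ | ⟨rfl, rfl, -, h⟩ | ⟨rfl, rfl, -⟩
        · simp
        · exact absurd h h2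
        · simp
    · refine ⟨(-1, L), (0, N), ?_⟩
      rintro _ ⟨⟨⟨x, y⟩, t⟩, hb, rfl⟩
      rw [mem_frontier hM hv hp] at hb
      rcases hb with ⟨rfl, rfl, -, h⟩ | ⟨rfl, rfl, -⟩ | ⟨rfl, rfl, -⟩
      · exact absurd h h1
      · simp
      · simp
  exact (Set.encard_le_encard hpq).trans ((Set.encard_insert_le _ _).trans
    (by rw [Set.encard_singleton]; exact one_add_one_eq_two.le))

theorem frontier_eq_empty_iff (hM : 0 < M) (hv : Valid M L N R)
    (hp : (tower M).Producible (asm M L N R β)) :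
    (tower M).frontier (asm M L N R β) = ∅ ↔ L = 4 * M ∧ N = 4 * M + 1 ∧ R = 4 * M := by
  constructor
  · intro h
    have hmem : ∀ x y t, ((x, y), t) ∉ (tower M).frontier (asm M L N R β) := by
      intro x y t; rw [h]; exact Set.notMem_empty _
    simp only [mem_frontier hM hv hp, not_or] at hmem
    have h1 : ¬ RightGrows M N R := fun h => (hmem 1 R _).1 ⟨rfl, rfl, rfl, h⟩
    have h2 : ¬ RightGrows M N L := fun h => (hmem (-1) L _).2.1 ⟨rfl, rfl, rfl, h⟩
    have h3 : ∀ t, ¬ MidGrows M L N R β t := fun t h => (hmem 0 N t).2.2 ⟨rfl, rfl, h⟩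
    have h4 : ¬ (N % 4 = 0 ∨ N % 4 = 2 ∨ N % 4 = 1 ∧ N < L ∧ N < R) := fun h => h3 (midTile M β N) (.inl ⟨h, rfl⟩)
    have h5 : ¬ (N % 4 = 3 ∧ N < R) := fun h =>
      h3 (tile M (N / 4) leftStart) (.inr (.inl ⟨h.1, h.2, rfl⟩))
    obtain ⟨hL, hR, hN1, hN, hcl, hcr, hgl, hgr, hc⟩ := hv
    unfold RightGrows at h1 h2
    omega
  · rintro ⟨rfl, rfl, rfl⟩
    refine Set.eq_empty_of_forall_notMem ?_
    rintro ⟨⟨x, y⟩, t⟩ h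
    rw [mem_frontier hM hv hp] at h
    unfold RightGrows MidGrows at h
    omega

end CoinTower

/-! ### Fairness of the race and the probability of each outcome -/

namespace CoinTower

open Kind Glue TileSystem

variable {M L N R : ℕ} {β : ℕ → Bool}

/-- The probability that a runner with `a` steps to go overtakes one with `b` steps to go, where the
`i`-th step from the end is made at rate `ρ i` by the first one and `ρ' i` by the second one. -/
noncomputable def race (ρ ρ' : ℕ → ℝ≥0) : ℕ → ℕ → ℝ≥0
  | 0, _ => 1
  | _ + 1, 0 => 0
  | a + 1, b + 1 => (ρ a * race ρ ρ' a (b + 1) + ρ' b * race ρ ρ' (a + 1) b) / (ρ a + ρ' b)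
  termination_by a b => a + b

theorem race_zero_left (ρ ρ' : ℕ → ℝ≥0) (b : ℕ) : race ρ ρ' 0 b = 1 := by rw [race]

theorem race_zero_right (ρ ρ' : ℕ → ℝ≥0) (a : ℕ) : race ρ ρ' (a + 1) 0 = 0 := by rw [race]

theorem race_balanced {ρ ρ' : ℕ → ℝ≥0} (a b : ℕ) (h : 0 < ρ a) :
    ρ a * race ρ ρ' a (b + 1) + ρ' b * race ρ ρ' (a + 1) b =
      (ρ a + ρ' b) * race ρ ρ' (a + 1) (b + 1) := by
  conv_rhs => rw [race]
  rw [mul_div_cancel₀]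
  positivity

/-- A race over three steps is fair if the rates agree up to order. -/
theorem race_three {ρ ρ' : ℕ → ℝ≥0} (h0 : 0 < ρ 0) (h1 : 0 < ρ 1) (h2 : 0 < ρ 2)
    (e0 : ρ' 0 = ρ 2) (e1 : ρ' 1 = ρ 1) (e2 : ρ' 2 = ρ 0) : race ρ ρ' 3 3 = 1 / 2 := by
  -- The equality in law of the two total times becomes an identity of rational functions in the
  -- three rates.
  simp only [race, e0, e1, e2]
  generalize ρ 0 = x at *
  generalize ρ 1 = y at *
  generalize ρ 2 = z at *
  field_simp
  ring

/-- The tile making the last, second last and third last step of the right column towards a coin. -/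
def rightStep (M k : ℕ) : ℕ → Tile M
  | 0 => tile M k leftStart
  | 1 => tile M (k + 1) relay
  | _ => tile M k rightStart

def leftStep (M k : ℕ) : ℕ → Tile M
  | 0 => tile M k rightStart
  | 1 => tile M (k + 1) relay
  | _ => tile M k leftStart

/-- The probability that the `k`-th coin comes out as `o` when the right and left columns have `a`
and `b` steps to go. -/
noncomputable def coinProb (P : Concentration (Tile M)) (k : ℕ) (o : Bool) (a b : ℕ) : ℝ≥0 :=
  match o with
  | true => race (fun i => P.conc (rightStep M k i)) (fun i => P.conc (leftStep M k i)) a b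
  | false => race (fun i => P.conc (leftStep M k i)) (fun i => P.conc (rightStep M k i)) b a

theorem coinProb_three (P : Concentration (Tile M)) (k : ℕ) (o : Bool) :
    coinProb P k o 3 3 = 1 / 2 := by
  cases o <;>
  exact race_three (P.conc_pos _) (P.conc_pos _) (P.conc_pos _) rfl rfl rfl

theorem coinProb_balanced (P : Concentration (Tile M)) (k : ℕ) (o : Bool) (a b : ℕ) :
    P.conc (rightStep M k a) * coinProb P k o a (b + 1) +
      P.conc (leftStep M k b) * coinProb P k o (a + 1) b =
    (P.conc (rightStep M k a) + P.conc (leftStep M k b)) * coinProb P k o (a + 1) (b + 1) := by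
  cases o
  · have := race_balanced (ρ := fun i => P.conc (leftStep M k i))
      (ρ' := fun i => P.conc (rightStep M k i)) b a (P.conc_pos _)
    simp only [coinProb]
    rw [add_comm, this, add_comm (P.conc (leftStep M k b))]
  · exact race_balanced (ρ := fun i => P.conc (rightStep M k i))
      (ρ' := fun i => P.conc (leftStep M k i)) a b (P.conc_pos _)

theorem coinProb_right (P : Concentration (Tile M)) (k : ℕ) (o : Bool) (b : ℕ) :
    coinProb P k o 0 (b + 1) = if true = o then 1 else 0 := by
  cases o <;> simp [coinProb, race_zero_left, race_zero_right]

theorem coinProb_left (P : Concentration (Tile M)) (k : ℕ) (o : Bool) (a : ℕ) :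
    coinProb P k o (a + 1) 0 = if false = o then 1 else 0 := by
  cases o <;> simp [coinProb, race_zero_left, race_zero_right]

/-- The probability of the remaining coins coming out as in `h`. -/
noncomputable def remainingProb (P : Concentration (Tile M)) (h : ℕ → Bool) (L N R : ℕ) : ℝ≥0 :=
  -- During a race a side column of height `N + 1` still has to place the coin tile, hence `N + 2`
  -- in the count of steps to go.
  if N % 4 = 3 then coinProb P (N / 4) (h (N / 4)) (N + 2 - R) (N + 2 - L) *
    (1 / 2) ^ (M - N / 4 - 1)
  else (1 / 2) ^ (M - N / 4)

/-- The number of tiles of an assembly in the column `x`. -/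
def height (A : Assembly (Tile M)) (x : ℤ) : ℕ := (A.filter fun a => a.1.1 = x).card

theorem height_left : height (asm M L N R β) (-1) = L := by
  rw [height, show (asm M L N R β).filter (fun a => a.1.1 = -1) =
    (Finset.range L).image (fun j : ℕ => (((-1 : ℤ), (j : ℤ)), leftTile M j)) by
      ext a; simp only [asm, Finset.mem_filter, Finset.mem_union, Finset.mem_image]; grind,
    Finset.card_image_of_injective, Finset.card_range]
  intro i j h
  simpa using congrArg (fun a => a.1.2) h

theorem height_mid : height (asm M L N R β) 0 = N := by
  rw [height, show (asm M L N R β).filter (fun a => a.1.1 = 0) =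
    (Finset.range N).image (fun j : ℕ => (((0 : ℤ), (j : ℤ)), midTile M β j)) by
      ext a; simp only [asm, Finset.mem_filter, Finset.mem_union, Finset.mem_image]; grind,
    Finset.card_image_of_injective, Finset.card_range]
  intro i j h
  simpa using congrArg (fun a => a.1.2) h

theorem height_right : height (asm M L N R β) 1 = R := by
  rw [height, show (asm M L N R β).filter (fun a => a.1.1 = 1) =
    (Finset.range R).image (fun j : ℕ => (((1 : ℤ), (j : ℤ)), rightTile M j)) by
      ext a; simp only [asm, Finset.mem_filter, Finset.mem_union, Finset.mem_image]; grind,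
    Finset.card_image_of_injective, Finset.card_range]
  intro i j h
  simpa using congrArg (fun a => a.1.2) h

/-- The result of the `k`-th coin in an assembly. -/
def result (A : Assembly (Tile M)) (k : ℕ) : Bool :=
  decide (((0, ((4 * k + 3 : ℕ) : ℤ)), tile M k leftStart) ∈ A)

theorem result_asm {k : ℕ} (hk : k < N / 4) : result (asm M L N R β) k = β k := by
  have h : ((0, ((4 * k + 3 : ℕ) : ℤ)), tile M k leftStart) ∈ asm M L N R β ↔ β k = true := by
    rw [mem_asm, occ_mid, if_pos (by omega), midTile_three]
    cases β k <;> simp [coinKind, tile]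
  rw [result, Bool.eq_iff_iff, decide_eq_true_iff, h]

/-- The probability of ending with the results `h`, as a function of the current assembly. -/
noncomputable def endProb (P : Concentration (Tile M)) (h : ℕ → Bool) (A : Assembly (Tile M)) :
    ℝ≥0 :=
  if ∀ k < height A 0 / 4, result A k = h k then
    remainingProb P h (height A (-1)) (height A 0) (height A 1)
  else 0

theorem endProb_asm (P : Concentration (Tile M)) (h : ℕ → Bool) :
    endProb P h (asm M L N R β) =
      if ∀ k < N / 4, β k = h k then remainingProb P h L N R else 0 := by
  rw [endProb, height_left, height_mid, height_right]
  refine if_congr (forall₂_congr fun k hk => ?_) rfl rfl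
  rw [result_asm hk]

/-- The terminal assembly with the results `h`. -/
def outcome (M : ℕ) (h : ℕ → Bool) : Assembly (Tile M) := asm M (4 * M) (4 * M + 1) (4 * M) h

theorem valid_outcome : Valid M (4 * M) (4 * M + 1) (4 * M) := by
  constructor <;> intros <;> omega

theorem outcome_eq_iff (h h' : ℕ → Bool) :
    outcome M h = outcome M h' ↔ ∀ k < M, h k = h' k := by
  constructor
  · intro e k hk
    rw [← result_asm (M := M) (L := 4 * M) (N := 4 * M + 1) (R := 4 * M) (β := h)
      (show k < (4 * M + 1) / 4 by omega), ← result_asm (M := M) (L := 4 * M) (N := 4 * M + 1)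
      (R := 4 * M) (β := h') (show k < (4 * M + 1) / 4 by omega)]
    exact congrArg (fun A => result A k) e
  · intro e
    exact asm_congr fun k hk => e k (by omega)

variable (P : Concentration (Tile M)) (h : ℕ → Bool)

theorem remainingProb_of_ne (hN : N % 4 ≠ 3) :
    remainingProb P h L N R = (1 / 2) ^ (M - N / 4) := if_neg hN

theorem remainingProb_mid (hv : Valid M L N R) (hN : N % 4 ≠ 3) (hN' : N < 4 * M + 1) :
    remainingProb P h L (N + 1) R = remainingProb P h L N R := by
  rw [remainingProb_of_ne P h hN]
  -- Launching a coin finds both side columns at height exactly `N`, hence three steps from deciding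
  -- it; the fair race replaces one factor 1/2.
  by_cases h2 : N % 4 = 2
  · have hL : L = N := by
      have := hv.left_cap; have := hv.gate_left (N / 4); omega
    have hR : R = N := by
      have := hv.right_cap; have := hv.gate_right (N / 4); omega
    subst hL
    subst hR
    rw [remainingProb, if_pos (by omega), show R + 1 + 2 - R = 3 by omega, coinProb_three,
      show (R + 1) / 4 = R / 4 by omega, ← pow_succ', show M - R / 4 - 1 + 1 = M - R / 4 by omega]
  · rw [remainingProb_of_ne P h (by omega), show (N + 1) / 4 = N / 4 by omega]

/-- Outside a race no attachment affects the result of a coin, so harmonicity is trivial there,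
whatever the concentrations. -/
theorem endProb_insert_of_ne (hM : 0 < M) (hv : Valid M L N R)
    (hp : (tower M).Producible (asm M L N R β)) (hN : N % 4 ≠ 3) {b : PlacedTile (Tile M)}
    (hb : b ∈ (tower M).frontier (asm M L N R β)) :
    endProb P h (insert b (asm M L N R β)) = endProb P h (asm M L N R β) := by
  obtain ⟨⟨x, y⟩, t⟩ := b
  rw [mem_frontier hM hv hp] at hb
  rcases hb with ⟨rfl, rfl, rfl, -⟩ | ⟨rfl, rfl, rfl, -⟩ | ⟨rfl, rfl, hb⟩
  · rw [insert_right, endProb_asm, endProb_asm, remainingProb_of_ne P h hN,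
      remainingProb_of_ne P h hN]
  · rw [insert_left, endProb_asm, endProb_asm, remainingProb_of_ne P h hN,
      remainingProb_of_ne P h hN]
  · have hN' := (hv.mid hb).mid_le
    obtain ⟨-, rfl⟩ := hb.resolve_right (by tauto)
    rw [insert_mid, endProb_asm, endProb_asm, remainingProb_mid P h hv hN (by omega),
      show (N + 1) / 4 = N / 4 by omega]

theorem endProb_insert_coin (hN : N % 4 = 3) (o : Bool) :
    endProb P h (insert ((0, (N : ℤ)), tile M (N / 4) (coinKind o)) (asm M L N R β)) =
      if ∀ k < N / 4, β k = h k then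
        (if o = h (N / 4) then 1 else 0) * (1 / 2) ^ (M - N / 4 - 1) else 0 := by
  rw [insert_coin hN, endProb_asm, remainingProb_of_ne P h (by omega),
    show (N + 1) / 4 = N / 4 + 1 by omega, Nat.sub_add_eq]
  have : (∀ k < N / 4 + 1, Function.update β (N / 4) o k = h k) ↔
      (∀ k < N / 4, β k = h k) ∧ o = h (N / 4) := by
    constructor
    · intro H
      refine ⟨fun k hk => ?_, by simpa using H (N / 4) (by omega)⟩
      simpa [hk.ne] using H k (by omega)
    · rintro ⟨H, H'⟩ k hk
      rcases Nat.lt_succ_iff_lt_or_eq.1 hk with hk | rfl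
      · simpa [hk.ne] using H k hk
      · simpa using H'
  simp only [this]
  by_cases h1 : ∀ k < N / 4, β k = h k
  · by_cases h2 : o = h (N / 4)
    · rw [if_pos ⟨h1, h2⟩, if_pos h1, if_pos h2, one_mul]
    · rw [if_neg (fun H => h2 H.2), if_pos h1, if_neg h2, zero_mul]
  · rw [if_neg (fun H => h1 H.1), if_neg h1]

/-- The attachment to the right column or by the right column to the coin. -/
def rightMove (M N R : ℕ) : PlacedTile (Tile M) :=
  if N < R then ((0, (N : ℤ)), tile M (N / 4) leftStart) else ((1, (R : ℤ)), rightTile M R)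

def leftMove (M N L : ℕ) : PlacedTile (Tile M) :=
  if N < L then ((0, (N : ℤ)), tile M (N / 4) rightStart) else ((-1, (L : ℤ)), leftTile M L)

theorem rightMove_ne_leftMove : rightMove M N R ≠ leftMove M N L := by
  unfold rightMove leftMove
  split_ifs <;> simp [tile]

/-- During a race each side has exactly one move. A column that has reached its cap competes for the
coin position, so the process is the two-runner race until the coin is placed. -/
theorem frontier_coin (hM : 0 < M) (hv : Valid M L N R)
    (hp : (tower M).Producible (asm M L N R β)) (hN : N % 4 = 3) :
    (tower M).frontier (asm M L N R β) = ({rightMove M N R, leftMove M N L} : Finset _) := by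
  ext ⟨⟨x, y⟩, t⟩
  have hr : RightGrows M N R ↔ ¬ N < R := by
    have := hv.mid_le; unfold RightGrows; omega
  have hl : RightGrows M N L ↔ ¬ N < L := by
    have := hv.mid_le; unfold RightGrows; omega
  rw [mem_frontier hM hv hp, hr, hl]
  simp only [MidGrows, hN, rightMove, leftMove, Finset.coe_insert, Finset.coe_singleton,
    Set.mem_insert_iff, Set.mem_singleton_iff]
  by_cases h1 : N < R <;> by_cases h2 : N < L <;> simp [h1, h2] <;> tauto

theorem rightMove_snd (hv : Valid M L N R) (hN : N % 4 = 3) {a : ℕ} (ha : N + 2 - R = a + 1) :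
    (rightMove M N R).2 = rightStep M (N / 4) a := by
  have := hv.right_cap
  have := hv.gate_right (N / 4)
  obtain ⟨k, rfl⟩ : ∃ k, N = 4 * k + 3 := ⟨N / 4, by omega⟩
  rw [rightMove, show (4 * k + 3) / 4 = k by omega]
  obtain rfl | rfl | rfl : R = 4 * k + 4 ∨ R = 4 * k + 3 ∨ R = 4 * k + 2 := by omega
  · rw [if_pos (by omega), show a = 0 by omega]; rfl
  · rw [if_neg (by omega), show a = 1 by omega, rightTile_three]; rfl
  · rw [if_neg (by omega), show a = 2 by omega, rightTile_two]; rfl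

theorem leftMove_snd (hv : Valid M L N R) (hN : N % 4 = 3) {a : ℕ} (ha : N + 2 - L = a + 1) :
    (leftMove M N L).2 = leftStep M (N / 4) a := by
  have := hv.left_cap
  have := hv.gate_left (N / 4)
  obtain ⟨k, rfl⟩ : ∃ k, N = 4 * k + 3 := ⟨N / 4, by omega⟩
  rw [leftMove, show (4 * k + 3) / 4 = k by omega]
  obtain rfl | rfl | rfl : L = 4 * k + 4 ∨ L = 4 * k + 3 ∨ L = 4 * k + 2 := by omega
  · rw [if_pos (by omega), show a = 0 by omega]; rfl
  · rw [if_neg (by omega), show a = 1 by omega, leftTile_three]; rfl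
  · rw [if_neg (by omega), show a = 2 by omega, leftTile_two]; rfl

theorem endProb_rightMove (hv : Valid M L N R) (hN : N % 4 = 3) {a b : ℕ}
    (ha : N + 2 - R = a + 1) (hb : N + 2 - L = b + 1) :
    endProb P h (insert (rightMove M N R) (asm M L N R β)) =
      if ∀ k < N / 4, β k = h k then
        coinProb P (N / 4) (h (N / 4)) a (b + 1) * (1 / 2) ^ (M - N / 4 - 1) else 0 := by
  have := hv.right_cap
  rw [rightMove]
  split_ifs with h1 h2 h2
  · rw [show a = 0 by omega, coinProb_right]
    exact (endProb_insert_coin P h hN true).trans (if_pos h2)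
  · exact (endProb_insert_coin P h hN true).trans (if_neg h2)
  · rw [insert_right, endProb_asm, if_pos h2, remainingProb, if_pos hN, hb,
      show N + 2 - (R + 1) = a by omega]
  · rw [insert_right, endProb_asm, if_neg h2]

theorem endProb_leftMove (hv : Valid M L N R) (hN : N % 4 = 3) {a b : ℕ}
    (ha : N + 2 - R = a + 1) (hb : N + 2 - L = b + 1) :
    endProb P h (insert (leftMove M N L) (asm M L N R β)) =
      if ∀ k < N / 4, β k = h k then
        coinProb P (N / 4) (h (N / 4)) (a + 1) b * (1 / 2) ^ (M - N / 4 - 1) else 0 := by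
  have := hv.left_cap
  rw [leftMove]
  split_ifs with h1 h2 h2
  · rw [show b = 0 by omega, coinProb_left]
    exact (endProb_insert_coin P h hN false).trans (if_pos h2)
  · exact (endProb_insert_coin P h hN false).trans (if_neg h2)
  · rw [insert_left, endProb_asm, if_pos h2, remainingProb, if_pos hN, ha,
      show N + 2 - (L + 1) = b by omega]
  · rw [insert_left, endProb_asm, if_neg h2]

theorem endProb_balanced_coin (hv : Valid M L N R) (hN : N % 4 = 3) :
    ∑ b ∈ {rightMove M N R, leftMove M N L},
        P.conc b.2 * endProb P h (insert b (asm M L N R β)) =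
      (∑ b ∈ {rightMove M N R, leftMove M N L}, P.conc b.2) * endProb P h (asm M L N R β) := by
  obtain ⟨a, ha⟩ : ∃ a, N + 2 - R = a + 1 := ⟨N + 1 - R, by have := hv.right_cap; omega⟩
  obtain ⟨b, hb⟩ : ∃ b, N + 2 - L = b + 1 := ⟨N + 1 - L, by have := hv.left_cap; omega⟩
  rw [Finset.sum_pair rightMove_ne_leftMove, Finset.sum_pair rightMove_ne_leftMove,
    endProb_rightMove P h hv hN ha hb, endProb_leftMove P h hv hN ha hb, rightMove_snd hv hN ha,
    leftMove_snd hv hN hb, endProb_asm, remainingProb, if_pos hN, ha, hb]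
  split_ifs
  · rw [← mul_assoc, ← mul_assoc, ← add_mul, coinProb_balanced, mul_assoc]
  · simp

theorem finite_frontier (hM : 0 < M) (hv : Valid M L N R)
    (hp : (tower M).Producible (asm M L N R β)) :
    ((tower M).frontier (asm M L N R β)).Finite := by
  refine (((Finset.finite_toSet {((1 : ℤ), (R : ℤ)), (-1, (L : ℤ)), (0, (N : ℤ))}).prod
    (Set.toFinite (Set.univ : Set (Tile M)))).subset ?_)
  rintro ⟨⟨x, y⟩, t⟩ hb
  rw [mem_frontier hM hv hp] at hb
  simp only [Finset.coe_insert, Finset.coe_singleton, Set.mem_prod, Set.mem_insert_iff,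
    Set.mem_singleton_iff, Prod.mk.injEq, Set.mem_univ, and_true]
  tauto

/-- Terminal assemblies give the source term, races are balanced by the recursion of `race`, and all
other attachments leave the value unchanged. -/
theorem endProb_harmonic (hM : 0 < M) {A : Assembly (Tile M)} (hp : (tower M).Producible A) :
    (endProb P h A : ℝ≥0∞) = ∑' B, (tower M).trans P A B * (endProb P h B : ℝ≥0∞) +
      if A = outcome M h then 1 else 0 := by
  obtain ⟨L, N, R, β, rfl, hv⟩ := Producible.exists_asm hM hp
  by_cases hf : (tower M).frontier (asm M L N R β) = ∅
  · simp only [trans_eq_zero_of_frontier_empty P hf, zero_mul, tsum_zero, zero_add]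
    obtain ⟨rfl, rfl, rfl⟩ := (frontier_eq_empty_iff hM hv hp).1 hf
    have := outcome_eq_iff (M := M) β h
    rw [endProb_asm, remainingProb_of_ne P h (by omega), show (4 * M + 1) / 4 = M by omega,
      Nat.sub_self, pow_zero]
    change _ = if outcome M β = outcome M h then 1 else 0
    simp only [this]
    split_ifs <;> simp
  · have hne : asm M L N R β ≠ outcome M h := by
      intro e
      rw [e] at hf hp
      exact hf ((frontier_eq_empty_iff hM valid_outcome hp).2 ⟨rfl, rfl, rfl⟩)
    rw [if_neg hne, add_zero]
    symm
    by_cases hN : N % 4 = 3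
    · refine tsum_trans_mul_of_balanced P (frontier_coin hM hv hp hN) (Finset.insert_nonempty _ _)
        (fun B => (endProb P h B : ℝ≥0∞)) ?_
      exact_mod_cast endProb_balanced_coin P h hv hN
    · have hfin := finite_frontier hM hv hp
      refine tsum_trans_mul_of_balanced P hfin.coe_toFinset.symm ?_
        (fun B => (endProb P h B : ℝ≥0∞)) ?_
      · rw [Set.Finite.toFinset_nonempty]
        exact Set.nonempty_iff_ne_empty.2 hf
      · rw [Finset.sum_mul]
        refine Finset.sum_congr rfl fun b hb => ?_
        rw [Set.Finite.mem_toFinset] at hb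
        rw [endProb_insert_of_ne P h hM hv hp hN hb]

theorem termProb_outcome (hM : 0 < M) : (tower M).termProb P (outcome M h) = (1 / 2) ^ M := by
  rw [termProb_eq_of_harmonic P (12 * M + 1) (fun _ => card_le hM) _
    (fun A => (endProb P h A : ℝ≥0∞)) (fun _ => endProb_harmonic P h hM), seed_eq (β := h),
    endProb_asm, if_pos (fun _ _ => rfl), remainingProb_of_ne P h (by norm_num)]
  simp [ENNReal.inv_pow]

end CoinTower

/-! ### Terminal assemblies and their partition into `n` classes -/

namespace CoinTower

open TileSystem

variable {M : ℕ}

/-- No growth sequence has to be exhibited: an outcome of positive probability is producible. Any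
concentration distribution serves, and the uniform one is taken. -/
theorem outcome_mem_terminal (hM : 0 < M) (h : ℕ → Bool) : outcome M h ∈ (tower M).terminal := by
  have : Nonempty (Tile M) := ⟨tile M 0 .relay⟩
  let P : Concentration (Tile M) :=
    ⟨fun _ => (Fintype.card (Tile M) : ℝ≥0)⁻¹,
      fun _ => inv_pos.2 (Nat.cast_pos.2 Fintype.card_pos), by
      rw [Finset.sum_const, Finset.card_univ, nsmul_eq_mul, mul_inv_cancel₀]
      exact Nat.cast_ne_zero.2 Fintype.card_ne_zero⟩
  obtain ⟨k, hk⟩ : ∃ k, (tower M).reachProb P k (outcome M h) ≠ 0 := by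
    by_contra! hk
    have := termProb_outcome P h hM
    rw [termProb, ENNReal.tsum_eq_zero.2 hk] at this
    exact absurd this.symm (pow_ne_zero _ (by norm_num))
  have hp := (producible_of_reachProb_ne_zero P hk).1
  exact ⟨hp, (frontier_eq_empty_iff hM valid_outcome hp).2 ⟨rfl, rfl, rfl⟩⟩

theorem exists_outcome_of_mem_terminal (hM : 0 < M) {A : Assembly (Tile M)}
    (hA : A ∈ (tower M).terminal) : ∃ h, A = outcome M h := by
  obtain ⟨L, N, R, β, rfl, hv⟩ := Producible.exists_asm hM hA.1
  obtain ⟨rfl, rfl, rfl⟩ := (frontier_eq_empty_iff hM hv hA.1).1 hA.2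
  exact ⟨β, rfl⟩

/-- The results of `M` coins, read as a number. -/
noncomputable def code (M : ℕ) : (Fin M → Bool) ≃ Fin (2 ^ M) :=
  Fintype.equivFinOfCardEq (by simp)

/-- The terminal assembly with a given code. -/
noncomputable def codedOutcome (M : ℕ) (c : Fin (2 ^ M)) : Assembly (Tile M) :=
  outcome M fun k => if hk : k < M then (code M).symm c ⟨k, hk⟩ else false

theorem codedOutcome_injective : Function.Injective (codedOutcome M) := by
  intro c d e
  rw [codedOutcome, codedOutcome, outcome_eq_iff] at e
  apply (code M).symm.injective
  ext ⟨k, hk⟩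
  simpa [hk] using e k hk

theorem range_codedOutcome (hM : 0 < M) : Set.range (codedOutcome M) = (tower M).terminal := by
  ext A
  constructor
  · rintro ⟨c, rfl⟩
    exact outcome_mem_terminal hM _
  · intro hA
    obtain ⟨h, rfl⟩ := exists_outcome_of_mem_terminal hM hA
    refine ⟨code M fun k => h k, ?_⟩
    rw [codedOutcome, outcome_eq_iff]
    intro k hk
    simp [hk]

theorem tsum_termProb_image (hM : 0 < M) (P : Concentration (Tile M)) (s : Finset (Fin (2 ^ M))) :
    (∑' A : codedOutcome M '' (s : Set (Fin (2 ^ M))), (tower M).termProb P A.1).toReal =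
      s.card * (1 / 2) ^ M := by
  rw [tsum_image (fun A => (tower M).termProb P A) codedOutcome_injective.injOn]
  have : ∀ c : (s : Set (Fin (2 ^ M))),
      (tower M).termProb P (codedOutcome M c.1) = (1 / 2) ^ M := fun c => termProb_outcome P _ hM
  simp only [this]
  rw [tsum_fintype, Finset.sum_const]
  simp

theorem card_residue (K n i : ℕ) (hn : 0 < n) (hi : i < n) :
    K / n ≤ (Finset.univ.filter fun c : Fin K => (c : ℕ) % n = i).card ∧
      (Finset.univ.filter fun c : Fin K => (c : ℕ) % n = i).card ≤ K / n + 1 := by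
  have h1 : (Finset.univ.filter fun c : Fin K => (c : ℕ) % n = i).card =
      Nat.count (· ≡ i [MOD n]) K := by
    rw [Nat.count_eq_card_filter_range, Finset.card_filter, Finset.card_filter,
      Fin.sum_univ_eq_sum_range (fun c => if c % n = i then 1 else 0)]
    simp only [Nat.ModEq, Nat.mod_eq_of_lt hi]
  rw [h1, Nat.count_modEq_card _ hn]
  split_ifs <;> simp

/-- Outcomes are sorted by their code modulo `n`. Class sizes differ by at most one, and all
outcomes are equally likely, so probabilities differ by at most that of one outcome. -/
theorem isRobustRandomGenerator (hM : 0 < M) {n : ℕ} (hn : 0 < n) (hnM : n ≤ 2 ^ M) {δ : ℝ}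
    (hδ : (1 / 2) ^ M ≤ δ) : (tower M).IsRobustRandomGenerator n δ := by
  refine ⟨isFinite_of_card_le (12 * M + 1) fun _ => card_le hM,
    fun i => codedOutcome M ''
      ((Finset.univ.filter fun c : Fin (2 ^ M) => (c : ℕ) % n = i : Finset (Fin (2 ^ M))) :
        Set (Fin (2 ^ M))), fun i => ?_, fun i j hij => ?_, ?_, fun P i j => ?_⟩
  · refine ⟨_, ⟨i, i.2.trans_le hnM⟩, ?_, rfl⟩
    simp [Nat.mod_eq_of_lt i.2]
  · rw [Set.disjoint_image_iff codedOutcome_injective, Finset.disjoint_coe,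
      Finset.disjoint_filter]
    intro c _ h h'
    exact hij (Fin.ext (h.symm.trans h'))
  · rw [← Set.image_iUnion, ← range_codedOutcome hM, ← Set.image_univ]
    congr 1
    refine Set.eq_univ_of_forall fun c => Set.mem_iUnion.2 ⟨⟨c % n, Nat.mod_lt _ hn⟩, ?_⟩
    simp
  · rw [tsum_termProb_image hM, tsum_termProb_image hM, ← sub_mul, abs_mul,
      abs_of_nonneg (by positivity : (0 : ℝ) ≤ (1 / 2) ^ M)]
    refine le_trans (mul_le_of_le_one_left (by positivity) ?_) hδ
    obtain ⟨h1, h2⟩ := card_residue (2 ^ M) n i hn i.2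
    obtain ⟨h3, h4⟩ := card_residue (2 ^ M) n j hn j.2
    rw [abs_le]
    constructor
    · rw [neg_le_sub_iff_le_add]
      exact_mod_cast (by omega)
    · rw [sub_le_iff_le_add]
      exact_mod_cast (by omega)

end CoinTower

/-! ### Choice of the parameters -/

theorem mainTheorem8 :
    ∃ c₁ c₂ C : ℝ, 0 < c₁ ∧ 0 < c₂ ∧ 0 < C ∧
      ∀ n s : ℕ, 2 ≤ n → 25 * ⌈Real.logb 2 (n : ℝ)⌉₊ < s →
        ∃ (G T : Type) (_ : DecidableEq G) (_ : Fintype T) (_ : DecidableEq T)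
            (Γ : TileSystem G T) (e : ℝ),
          Γ.temperature = 2 ∧
          Γ.seed.card = 1 ∧
          Γ.IsExtensible 2 ∧
          Γ.space ≤ (s : ℕ∞) ∧
          (Fintype.card T : ℝ) ≤ C * ((s : ℝ) + Real.logb 2 (n : ℝ)) ∧
          c₁ * ((s : ℝ) / Real.logb 2 (n : ℝ)) ≤ e ∧
          e ≤ c₂ * ((s : ℝ) / Real.logb 2 (n : ℝ)) ∧
          Γ.IsRobustRandomGenerator n ((2 : ℝ) ^ (-e)) := by
  refine ⟨1 / 50, 1 / 50, 1, by norm_num, by norm_num, by norm_num, fun n s hn hs => ?_⟩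
  have hn' : (2 : ℝ) ≤ n := by exact_mod_cast hn
  have hlog : 1 ≤ Real.logb 2 n := by
    rw [Real.le_logb_iff_rpow_le one_lt_two (by linarith), Real.rpow_one]
    exact hn'
  have hceil : 1 ≤ ⌈Real.logb 2 (n : ℝ)⌉₊ := Nat.one_le_ceil_iff.2 (by linarith)
  -- The hypothesis on `s` gives `M ≥ ⌈log₂ n⌉ ≥ 1`, so there are at least `n` outcomes; the same
  -- bound makes `12 * M + 1` tiles and `9 * (M + 1)` tile types at most `s`.
  set M := s / 25 with hMdef
  have hML : ⌈Real.logb 2 (n : ℝ)⌉₊ ≤ M := by omega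
  have hM : 0 < M := by omega
  have hnM : n ≤ 2 ^ M := by
    have h1 : Real.logb 2 n ≤ (M : ℝ) := (Nat.le_ceil _).trans (by exact_mod_cast hML)
    rw [Real.logb_le_iff_le_rpow one_lt_two (by linarith), Real.rpow_natCast] at h1
    exact_mod_cast h1
  -- The bias is only an upper bound, so `e` may be any number up to `M`; setting it equal to `s /
  -- (50 log₂ n)` lets both constants be 1/50.
  refine ⟨CoinTower.Glue, CoinTower.Tile M, inferInstance, inferInstance, inferInstance,
    CoinTower.tower M, 1 / 50 * ((s : ℝ) / Real.logb 2 n), rfl, Finset.card_singleton _,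
    CoinTower.isExtensible hM, (CoinTower.space_le hM).trans ?_, ?_, le_rfl, le_rfl,
    CoinTower.isRobustRandomGenerator hM (by omega) hnM ?_⟩
  · exact_mod_cast (by omega : 12 * M + 1 ≤ s)
  · have h1 : (Fintype.card (CoinTower.Tile M) : ℝ) ≤ s := by
      rw [Fintype.card_prod, Fintype.card_fin, CoinTower.card_kind]
      exact_mod_cast (by omega)
    linarith
  · rw [one_div, inv_pow, Real.rpow_neg zero_le_two]
    refine inv_anti₀ (by positivity) ?_
    rw [← Real.rpow_natCast]
    refine Real.rpow_le_rpow_of_exponent_le one_le_two ?_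
    -- Rounding down loses at most a factor 2 since `M ≥ 1`: `s < 25 * (M + 1) ≤ 50 * M`.
    have h1 : (s : ℝ) ≤ 50 * M := by exact_mod_cast (by omega)
    have h2 : (s : ℝ) / Real.logb 2 n ≤ s := div_le_self (by positivity) hlog
    linarith
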